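/- **Setting.** Let $D_1,\dots,D_n$ ($n\ge 1$) be probability distributions on a space $\mathcal Z$, let $\Theta$ be a non-empty convex compact subset of a finite-dimensional real normed space $(E,\|\cdot\|_E)$, let $\mathcal H=\{h_\theta\}_{\theta\in\Theta}$ be a class of models parameterized by $\Theta$, and let $\ell:\mathcal H\times\mathcal Z\to[0,1]$ be a loss such that for every $z$ the map $\theta\mapsto \ell(h_\theta,z)$ is convex and 1-smooth on $\Theta$, i.e. it is differentiable with gradient $\nabla_\theta\ell(h_\theta,z)\in E^*$ of dual norm at most $1$ at every $\theta\in\Theta$. Let $R=\max_{\theta,\theta'\in\Theta}\|\theta-\theta'\|_E$. Write $\mathcal R_i(h)=\mathbb E_{z\sim D_i}\,\ell(h,z)$ and $\mathrm{OPT}=\min_{\theta\in\Theta}\max_i \mathcal R_i(h_\theta)$. Let $\omega:\Theta\to\mathbb R$ be a distance-generating function: continuous, strongly convex with modulus $1$ with respect to $\|\cdot\|_E$, and with a selection $\omega'$ of its subdifferential that is continuous on the set $\Theta^o\subseteq\Theta$ where the subdifferential is non-empty. Put $V(w,u)=\omega(u)-\omega(w)-\langle\omega'(w),u-w\rangle$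 for $w \in \Theta^o$, $u \in \Theta$, $\theta^c=\arg\min_{\Theta^o}\omega$, and let $D_\Theta=\max_{u\in\Theta}V(\theta^c,u)$ be the Bregman radius. **Algorithm** (with $T\ge1$ steps). Example oracle $\mathrm{EX}(D_i)$ returns an independent sample of $D_i$ at each call. The learner starts at $\theta^{(1)}=\theta^c$; the auditor has cumulative cost estimates $c^{(1)}=0\in\mathbb R^n$ and plays Hedge, $w^{(t)}_i\propto\exp(-\eta' c^{(t)}_i)$. For $t=2,\dots,T$: 1. draw $i\sim w^{(t-1)}$, sample $z$ from $\mathrm{EX}(D_i)$, and set (online mirror descent) $\theta^{(t)}=\arg\min_{u\in\Theta}\big\{\eta\langle\nabla_\theta\ell(h_{\theta^{(t-1)}},z),u\rangle+V(\theta^{(t-1)},u)\big\}$; 2. draw $k\sim w^{(t-1)}$ independently, sample $z'$ from $\mathrm{EX}(D_k)$, and (Exp3 with implicit exploration, the high-probability variant of ELP on singletons) let $c^{(t)}=c^{(t-1)}+\frac{1-\ell(h_{\theta^{(t-1)}},z')}{w^{(t-1)}_k+\eta'/2}\,e_k$. Return $\overline\theta=\frac1T\sum_{t=1}^T\theta^{(t)}$.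 The step sizes are $\eta=\sqrt{2D_\Theta/T}$ and $\eta'=\sqrt{\log(n/\delta)/(nT)}$. **Theorem.** There is a universal constant $C>0$ such that for every such group DRO problem (equivalently, agnostic federated learning problem), every distance-generating function, every $\epsilon>0$ and every $\delta\in(0,1)$, the algorithm run with $$T=\Big\lceil C\,\epsilon^{-2}\big(D_\Theta+n\log(n/\delta)+R\log(1/\delta)\big)\Big\rceil$$ makes at most $2C\,\epsilon^{-2}\big(D_\Theta+n\log(n/\delta)+R\log(1/\delta)\big)$ calls to the example oracles on every execution, and with probability at least $1-\delta$ its output is a proper $\epsilon$-optimal model: $\overline\theta\in\Theta$ and $\max_i\mathcal R_i(h_{\overline\theta})\le\mathrm{OPT}+\epsilon$. -/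

import Mathlib

open MeasureTheory Set

noncomputable section

/-! ### Adaptive randomized algorithms with access to example oracles -/

/-- A randomized algorithm with on-demand access to example oracles `EX(D_1), …, EX(D_n)` for
distributions on `Z`, returning an element of `α`. It may return a value, call an oracle of its
choice and continue depending on the datapoint received, or flip internal coins, i.e. draw an index
from a probability vector, and continue depending on the index drawn. -/
inductive OracleAlg (n : ℕ) (Z : Type*) (α : Type*) where
  | ret (a : α) : OracleAlg n Z α
  | query (i : Fin n) (next : Z → OracleAlg n Z α) : OracleAlg n Z α
  | draw (p : stdSimplex ℝ (Fin n)) (next : Fin n → OracleAlg n Z α) : OracleAlg n Z α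

namespace OracleAlg

/-- The law of the output when `EX(D_i)` returns independent samples of `D i`. -/
def law {n : ℕ} {Z α : Type*} [MeasurableSpace Z] [MeasurableSpace α] (D : Fin n → Measure Z) :
    OracleAlg n Z α → Measure α
  | ret a => Measure.dirac a
  | query i next => (D i).bind fun z => law D (next z)
  | draw p next => ∑ j, ENNReal.ofReal (p.1 j) • law D (next j)

/-- On every execution, the algorithm makes at most `N` calls to the example oracles. -/
def CallsAtMost {n : ℕ} {Z α : Type*} : OracleAlg n Z α → ℕ → Prop
  | ret _, _ => True
  | query _ _, 0 => False
  | query _ next, N + 1 => ∀ z, CallsAtMost (next z) N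
  | draw _ next, N => ∀ j, CallsAtMost (next j) N

end OracleAlg

/-! ### Group DRO problems -/

/-- The data of a group DRO problem: `n` data distributions on `Z`, a parameter space `Θ`, the
parameterization `θ ↦ h_θ` of the models, one loss function, and gradients `∇_θ ℓ(h_θ, z)`. -/
structure GroupDRO (n : ℕ) (E Z H : Type*) [NormedAddCommGroup E] [NormedSpace ℝ E]
    [MeasurableSpace Z] where
  dist : Fin n → Measure Z
  params : Set E
  model : E → H
  loss : H → Z → ℝ
  grad : E → Z → E →L[ℝ] ℝ

namespace GroupDRO

variable {n : ℕ} {E Z H : Type*} [NormedAddCommGroup E] [NormedSpace ℝ E] [MeasurableSpace Z]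

/-- The standing assumptions: the `D_i` are probability distributions, the parameter space is convex
and compact, and the loss is `[0,1]`-valued, convex and differentiable in the parameter, with
gradients of (dual) norm at most one. Derivatives are taken within the parameter space, which may
have empty interior, as a probability simplex does. -/
structure IsSmoothConvex [MeasurableSpace E] (P : GroupDRO n E Z H) : Prop where
  isProbabilityMeasure : ∀ i, IsProbabilityMeasure (P.dist i)
  nonempty : P.params.Nonempty
  isCompact : IsCompact P.params
  convex : Convex ℝ P.params
  loss_mem : ∀ θ ∈ P.params, ∀ z, P.loss (P.model θ) z ∈ Icc (0 : ℝ) 1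
  convexOn : ∀ z, ConvexOn ℝ P.params fun θ => P.loss (P.model θ) z
  hasGrad : ∀ θ ∈ P.params, ∀ z,
    HasFDerivWithinAt (fun θ' => P.loss (P.model θ') z) (P.grad θ z) P.params θ
  norm_grad_le : ∀ θ ∈ P.params, ∀ z, ‖P.grad θ z‖ ≤ 1
  measurable_loss : Measurable fun x : P.params × Z => P.loss (P.model x.1) x.2
  measurable_grad : Measurable fun x : P.params × Z => P.grad x.1 x.2

/-- The expected loss of `h` on the `i`-th distribution. -/
def risk (P : GroupDRO n E Z H) (i : Fin n) (h : H) : ℝ := ∫ z, P.loss h z ∂P.dist i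

/-- The worst expected loss of `h` over the distributions. -/
def worstRisk (P : GroupDRO n E Z H) (h : H) : ℝ := ⨆ i, P.risk i h

/-- `OPT`, the least worst-case expected loss of a model in the class. -/
def opt (P : GroupDRO n E Z H) : ℝ := sInf ((fun θ => P.worstRisk (P.model θ)) '' P.params)

/-- The parameters of proper `ε`-optimal models. -/
def epsOptimal (P : GroupDRO n E Z H) (ε : ℝ) : Set E :=
  {θ | θ ∈ P.params ∧ P.worstRisk (P.model θ) ≤ P.opt + ε}

end GroupDRO

/-! ### Distance-generating functions and the Bregman radius -/

section Bregman

variable {E : Type*} [NormedAddCommGroup E] [NormedSpace ℝ E]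

/-- The subdifferential at `θ` of a function on `Θ`. -/
def subdiff (Θ : Set E) (ω : E → ℝ) (θ : E) : Set (E →L[ℝ] ℝ) :=
  {s | ∀ u ∈ Θ, ω θ + s (u - θ) ≤ ω u}

/-- `Θ°`, the points of `Θ` at which the subdifferential of `ω` is non-empty. -/
def subdiffDomain (Θ : Set E) (ω : E → ℝ) : Set E := {θ | θ ∈ Θ ∧ (subdiff Θ ω θ).Nonempty}

/-- `ω` is a distance-generating function on `Θ`, with `ω'` as the continuous selection of its
subdifferential on `Θ°`. -/
structure IsDistanceGenerating (Θ : Set E) (ω : E → ℝ) (ω' : E → E →L[ℝ] ℝ) : Prop where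
  continuousOn : ContinuousOn ω Θ
  strongConvexOn : StrongConvexOn Θ 1 ω
  mem_subdiff : ∀ θ ∈ subdiffDomain Θ ω, ω' θ ∈ subdiff Θ ω θ
  continuousOn_selection : ContinuousOn ω' (subdiffDomain Θ ω)

/-- A minimizer of `f` over `s` (arbitrary if there is none). -/
def argminOn (f : E → ℝ) (s : Set E) : E := Classical.epsilon fun x => x ∈ s ∧ IsMinOn f s x

/-- The center of `Θ` with respect to `ω`. -/
def center (Θ : Set E) (ω : E → ℝ) : E := argminOn ω (subdiffDomain Θ ω)

/-- The prox function (Bregman divergence) `V(w, u)`. -/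
def bregman (ω : E → ℝ) (ω' : E → E →L[ℝ] ℝ) (w u : E) : ℝ := ω u - ω w - ω' w (u - w)

/-- The Bregman radius of `Θ`: the maximum over `u ∈ Θ` of `V(θᶜ, u)`. -/
def bregmanRadius (Θ : Set E) (ω : E → ℝ) (ω' : E → E →L[ℝ] ℝ) : ℝ :=
  sSup (bregman ω ω' (center Θ ω) '' Θ)

end Bregman

/-! ### Online learning algorithms -/

/-- An online learning algorithm choosing actions in `A` upon feedback in `F`, with its memory in
`S`. -/
structure OnlineAlg (S F A : Type*) where
  init : S
  act : S → A
  update : S → F → S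

/-- Online mirror descent on `Θ` with step size `η`: start at the center and, upon the linear cost
`g`, move from `θ` to the minimizer over `u ∈ Θ` of `η ⟨g, u⟩ + V(θ, u)`. -/
def mirrorDescent {E : Type*} [NormedAddCommGroup E] [NormedSpace ℝ E] (Θ : Set E) (ω : E → ℝ)
    (ω' : E → E →L[ℝ] ℝ) (η : ℝ) : OnlineAlg E (E →L[ℝ] ℝ) E where
  init := center Θ ω
  act := id
  update θ g := argminOn (fun u => η * g u + bregman ω ω' θ u) Θ

/-- The Hedge distribution with learning rate `η` for the cumulative costs `c`. -/
def hedge {n : ℕ} [NeZero n] (η : ℝ) (c : Fin n → ℝ) : stdSimplex ℝ (Fin n) :=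
  ⟨fun i => Real.exp (-η * c i) / ∑ j, Real.exp (-η * c j), by
    have h : 0 < ∑ j, Real.exp (-η * c j) :=
      Finset.sum_pos (fun j _ => Real.exp_pos _) Finset.univ_nonempty
    refine ⟨fun i => div_nonneg (Real.exp_pos _).le h.le, ?_⟩
    rw [← Finset.sum_div, div_self h.ne']⟩

/-- The high-probability bandit algorithm for `n` meta-actions (Exp3 with implicit exploration, i.e.
the high-probability variant of ELP on the partition into singletons), with learning rate `η` and
exploration parameter `γ`. It plays Hedge on cumulative estimated costs. When the cost `c` of the
single meta-action `k` is observed, the estimated cost of `k` is `c / (w_k + γ)` and that of the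
other meta-actions is zero. -/
def exp3IX (n : ℕ) [NeZero n] (η γ : ℝ) :
    OnlineAlg (Fin n → ℝ) (Fin n × ℝ) (stdSimplex ℝ (Fin n)) where
  init := 0
  act c := hedge η c
  update c f := c + Pi.single f.1 (f.2 / ((hedge η c).1 f.1 + γ))

/-! ### The general recipe -/

namespace GroupDRO

variable {n : ℕ} {E Z H : Type*} [NormedAddCommGroup E] [NormedSpace ℝ E] [MeasurableSpace Z]

/-- `m` further iterations of the general recipe with total number of steps `T`, where the learner
and the auditor have memories `s` and `r`, and `a` is the sum of the learner's actions so far.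
In each iteration, with current actions `θ` and `w`, an index `i` is drawn from `w`, a datapoint `z`
is sampled from `EX(D_i)`, and the learner is given the linear cost `∇ℓ(h_θ, z)`; then an index `k`
is drawn from `w`, a datapoint `z'` is sampled from `EX(D_k)`, and the auditor observes the cost
`1 - ℓ(h_θ, z')` of its meta-action `k`. -/
def recipeLoop (P : GroupDRO n E Z H) {S R : Type*} (L : OnlineAlg S (E →L[ℝ] ℝ) E)
    (A : OnlineAlg R (Fin n × ℝ) (stdSimplex ℝ (Fin n))) (T : ℕ) :
    ℕ → S → R → E → OracleAlg n Z E
  | 0, _, _, a => .ret ((T : ℝ)⁻¹ • a)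
  | m + 1, s, r, a =>
    .draw (A.act r) fun i => .query i fun z =>
      .draw (A.act r) fun k => .query k fun z' =>
        recipeLoop P L A T m (L.update s (P.grad (L.act s) z))
          (A.update r (k, 1 - P.loss (P.model (L.act s)) z'))
          (a + L.act (L.update s (P.grad (L.act s) z)))

/-- The general recipe with learner `L` and auditor `A`: it initializes the actions of step `1`,
performs the iterations `t = 2, …, T`, and returns the average of the learner's `T` actions. -/
def recipe (P : GroupDRO n E Z H) {S R : Type*} (L : OnlineAlg S (E →L[ℝ] ℝ) E)
    (A : OnlineAlg R (Fin n × ℝ) (stdSimplex ℝ (Fin n))) (T : ℕ) : OracleAlg n Z E :=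
  P.recipeLoop L A T (T - 1) L.init A.init (L.act L.init)

/-- The general recipe with online mirror descent as the learner and the high-probability bandit
algorithm as the auditor. The step sizes are functions of `D_Θ`, `n`, `δ` and `T` only. -/
def mirrorDescentRecipe [NeZero n] (P : GroupDRO n E Z H) (ω : E → ℝ) (ω' : E → E →L[ℝ] ℝ)
    (δ : ℝ) (T : ℕ) : OracleAlg n Z E :=
  P.recipe (mirrorDescent P.params ω ω' (Real.sqrt (2 * bregmanRadius P.params ω ω' / T)))
    (exp3IX n (Real.sqrt (Real.log (n / δ) / (n * T)))
      (Real.sqrt (Real.log (n / δ) / (n * T)) / 2)) T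

/-- The complexity `D_Θ + n log(n/δ) + R log(1/δ)`, with `R` the diameter of the parameter space. -/
def complexity (P : GroupDRO n E Z H) (ω : E → ℝ) (ω' : E → E →L[ℝ] ℝ) (δ : ℝ) : ℝ :=
  bregmanRadius P.params ω ω' + n * Real.log (n / δ) + Metric.diam P.params * Real.log (1 / δ)

end GroupDRO

end

/-! Read the algorithm as a zero-sum game. Fix a minimizer `u` of the worst risk and a group `j`.
The learner's regret against `u` is tracked by V(θ, u)/η, and the auditor's regret against always
playing `j` by the log-sum-exp potential `hedgePotential`. Let G be the accumulated excess of the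
`j`-th risk of the iterates over OPT. In the conditional expectation of one step the two regrets
cancel the increment of G: what remains is Σ w_i R_i(u) - OPT ≤ 0, plus second-order terms in the
step sizes and the exploration cost η' n.

High probability comes from an exponential supermartingale rather than from separate concentration
bounds. With λ = η'/2, the exponential of λ(G + both potentials), corrected by a deterministic drift
per remaining step, does not increase in expectation. Since the algorithm is a tree of draws and
queries, this is a backward induction on the number of remaining steps (`law_recipeLoop_le`). The
initial value is at most δ/n by the choice of T (`exponent_le_neg_log`), and a union bound over `j`
finishes. The term R log(1/δ) serves only to enlarge T.

The one-step inequalities are `bregman_mirrorDescent_update_le` for the learner and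
`exp_hedgePotential_update_le` for the auditor. The former needs care, because the optimality
condition at the new iterate gives some subgradient there, not the selected one.
`IsDistanceGenerating.sub_apply_nonneg` shows that a continuous selection compares favourably with
every other subgradient. -/

noncomputable section

/-! ### Convex analysis: subgradients, the prox map and one step of mirror descent. -/

section ConvexAnalysis

variable {E : Type*} [NormedAddCommGroup E] [NormedSpace ℝ E] {Θ : Set E} {ω : E → ℝ}

omit [NormedSpace ℝ E] in
theorem argminOn_spec {f : E → ℝ} {s : Set E} (h : ∃ x ∈ s, IsMinOn f s x) :
    argminOn f s ∈ s ∧ IsMinOn f s (argminOn f s) :=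
  Classical.epsilon_spec h

omit [NormedSpace ℝ E] in
theorem argminOn_spec_of_isCompact {f : E → ℝ} {s : Set E} (hs : IsCompact s)
    (hne : s.Nonempty) (hf : ContinuousOn f s) :
    argminOn f s ∈ s ∧ IsMinOn f s (argminOn f s) :=
  argminOn_spec (hs.exists_isMinOn hne hf)

/-- Lets t → 0 in first-order conditions obtained along a segment after division by t. -/
theorem le_of_forall_one_sub_mul_le {a b c : ℝ}
    (h : ∀ t : ℝ, 0 < t → t < 1 → a + (1 - t) * c ≤ b) : a + c ≤ b := by
  have hlim : Filter.Tendsto (fun t : ℝ => a + (1 - t) * c) (nhdsWithin 0 (Ioi 0))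
      (nhds (a + (1 - 0) * c)) :=
    (Continuous.tendsto (by fun_prop) 0).mono_left nhdsWithin_le_nhds
  rw [sub_zero, one_mul] at hlim
  refine le_of_tendsto hlim ?_
  filter_upwards [Ioo_mem_nhdsGT (zero_lt_one' ℝ)] with t ht using h t ht.1 ht.2

/-- A convex function lies above its tangents, for derivatives within the domain. -/
theorem ConvexOn.add_fderivWithin_le {f : E → ℝ} {g : E →L[ℝ] ℝ} {x u : E}
    (hf : ConvexOn ℝ Θ f) (hx : x ∈ Θ) (hu : u ∈ Θ) (hg : HasFDerivWithinAt f g Θ x) :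
    f x + g (u - x) ≤ f u := by
  have hmaps : MapsTo (fun t : ℝ => x + t • (u - x)) (Icc 0 1) Θ := fun t ht =>
    hf.1.add_smul_sub_mem hx hu ht
  have hline : HasDerivWithinAt (fun t : ℝ => x + t • (u - x)) (u - x) (Icc 0 1) 0 := by
    simpa using (((hasDerivAt_id (0 : ℝ)).smul_const (u - x)).const_add x).hasDerivWithinAt
  have hcomp : HasDerivWithinAt (fun t : ℝ => f (x + t • (u - x))) (g (u - x)) (Icc 0 1) 0 := by
    refine HasFDerivWithinAt.comp_hasDerivWithinAt (t := Θ) 0 ?_ hline hmaps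
    simpa using hg
  have hconv : ConvexOn ℝ (Icc (0 : ℝ) 1) fun t : ℝ => f (x + t • (u - x)) := by
    refine ⟨convex_Icc 0 1, fun s hs t ht a b ha hb hab => ?_⟩
    have := hf.2 (hmaps hs) (hmaps ht) ha hb hab
    convert this using 2
    simp only [smul_add, smul_smul, smul_eq_mul]
    have : x = a • x + b • x := by rw [← add_smul, hab, one_smul]
    rw [add_smul]
    nth_rewrite 1 [this]
    abel
  have := hconv.le_slope_of_hasDerivWithinAt (by simp) (by simp) zero_lt_one hcomp
  simp [slope_def_field] at this
  simpa using (by linarith : f x + (g u - g x) ≤ f u)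

theorem StrongConvexOn.add_half_sq_le {x u : E} {s : E →L[ℝ] ℝ} (hω : StrongConvexOn Θ 1 ω)
    (hx : x ∈ Θ) (hs : s ∈ subdiff Θ ω x) (hu : u ∈ Θ) :
    ω x + s (u - x) + ‖u - x‖ ^ 2 / 2 ≤ ω u := by
  refine le_of_forall_one_sub_mul_le fun t ht0 ht1 => ?_
  have h1 := hω.2 hx hu (sub_nonneg.2 ht1.le) ht0.le (by ring)
  have h2 := hs _ (hω.1 hx hu (sub_nonneg.2 ht1.le) ht0.le (by ring))
  have h3 : (1 - t) • x + t • u - x = t • (u - x) := by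
    rw [sub_smul, one_smul, smul_sub]; abel
  rw [h3, map_smul] at h2
  rw [norm_sub_rev x u] at h1
  simp only [smul_eq_mul] at h1 h2
  refine le_of_mul_le_mul_left (a := t) ?_ ht0
  nlinarith

/-- Strong monotonicity of the subdifferential: add the two strengthened subgradient inequalities.
It makes the inverse of the subdifferential single-valued and 1-Lipschitz. -/
theorem StrongConvexOn.sq_norm_sub_le {x y : E} {p q : E →L[ℝ] ℝ} (hω : StrongConvexOn Θ 1 ω)
    (hx : x ∈ Θ) (hy : y ∈ Θ) (hp : p ∈ subdiff Θ ω x) (hq : q ∈ subdiff Θ ω y) :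
    ‖x - y‖ ^ 2 ≤ (p - q) (x - y) := by
  have h1 := hω.add_half_sq_le hx hp hy
  have h2 := hω.add_half_sq_le hy hq hx
  rw [norm_sub_rev y x, ← neg_sub x y, map_neg] at h1
  rw [sub_apply]
  linarith

theorem StrongConvexOn.norm_sub_le {x y : E} {p q : E →L[ℝ] ℝ} (hω : StrongConvexOn Θ 1 ω)
    (hx : x ∈ Θ) (hy : y ∈ Θ) (hp : p ∈ subdiff Θ ω x) (hq : q ∈ subdiff Θ ω y) :
    ‖x - y‖ ≤ ‖p - q‖ := by
  have h1 := hω.sq_norm_sub_le hx hy hp hq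
  have h2 := (le_abs_self _).trans ((p - q).le_opNorm (x - y))
  by_contra! h
  nlinarith [norm_nonneg (x - y), norm_nonneg (p - q)]

/-- The minimizer of `ω - p` over `Θ`. -/
def proxPoint (Θ : Set E) (ω : E → ℝ) (p : E →L[ℝ] ℝ) : E := argminOn (fun u => ω u - p u) Θ

theorem mem_subdiff_of_isMinOn {p : E →L[ℝ] ℝ} {x : E}
    (h : IsMinOn (fun u => ω u - p u) Θ x) : p ∈ subdiff Θ ω x := fun u hu => by
  have : ω x - p x ≤ ω u - p u := h hu
  rw [map_sub]; linarith

theorem proxPoint_spec (hΘ : IsCompact Θ) (hne : Θ.Nonempty) (hc : ContinuousOn ω Θ)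
    (p : E →L[ℝ] ℝ) : proxPoint Θ ω p ∈ Θ ∧ p ∈ subdiff Θ ω (proxPoint Θ ω p) :=
  have h := argminOn_spec_of_isCompact hΘ hne (hc.sub p.continuous.continuousOn)
  ⟨h.1, mem_subdiff_of_isMinOn h.2⟩

theorem lipschitzWith_proxPoint (hΘ : IsCompact Θ) (hne : Θ.Nonempty) (hc : ContinuousOn ω Θ)
    (hω : StrongConvexOn Θ 1 ω) : LipschitzWith 1 (proxPoint Θ ω) :=
  LipschitzWith.of_dist_le_mul fun p q => by
    have hp := proxPoint_spec hΘ hne hc p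
    have hq := proxPoint_spec hΘ hne hc q
    simpa [dist_eq_norm] using hω.norm_sub_le hp.1 hq.1 hp.2 hq.2

theorem StrongConvexOn.proxPoint_eq {x : E} {p : E →L[ℝ] ℝ} (hω : StrongConvexOn Θ 1 ω)
    (hΘ : IsCompact Θ) (hc : ContinuousOn ω Θ) (hx : x ∈ Θ) (hp : p ∈ subdiff Θ ω x) :
    x = proxPoint Θ ω p := by
  have h := proxPoint_spec hΘ ⟨x, hx⟩ hc p
  have := hω.norm_sub_le hx h.1 hp h.2
  simpa [sub_eq_zero] using this

/-- Points with a subgradient are dense in the domain of a convex continuous function. -/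
theorem exists_mem_subdiffDomain_norm_sub_lt [FiniteDimensional ℝ E] (hΘ : IsCompact Θ)
    (hc : ContinuousOn ω Θ) (hω : ConvexOn ℝ Θ ω) {y : E} (hy : y ∈ Θ) {r : ℝ} (hr : 0 < r) :
    ∃ x ∈ subdiffDomain Θ ω, ‖x - y‖ < r := by
  obtain ⟨b, hb, hbmin⟩ := hΘ.exists_isMinOn ⟨y, hy⟩ hc
  let A : E ≃L[ℝ] EuclideanSpace ℝ (Fin (Module.finrank ℝ E)) := toEuclidean
  let c : ℝ := ‖(A.symm : EuclideanSpace ℝ (Fin (Module.finrank ℝ E)) →L[ℝ] E)‖ + 1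
  have hcpos : 0 < c := by positivity
  -- Penalty weight: minimality gives `K * ‖A (x - y)‖ ^ 2 ≤ ω y - ω b`, so this `K` forces `c * ‖A
  -- (x - y)‖ < r`. The `+ 1` keeps `K` positive and the inequality strict.
  let K : ℝ := (ω y - ω b + 1) * (c / r) ^ 2
  have hyb : ω b ≤ ω y := hbmin hy
  have hK : 0 < K := by
    have : 0 < ω y - ω b + 1 := by linarith
    positivity
  -- Proximal regularization. The penalty is Euclidean because the norm of `E` need not be
  -- differentiable; minus the gradient of the penalty is then a subgradient of `ω` at the
  -- minimizer.
  obtain ⟨x, hx, hxmin⟩ := hΘ.exists_isMinOn (f := fun x => ω x + K * ‖A (x - y)‖ ^ 2) ⟨y, hy⟩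
    (hc.add (Continuous.continuousOn (by fun_prop)))
  refine ⟨x, ⟨hx, (-(2 * K)) • (innerSL ℝ (A (x - y))).comp (A : E →L[ℝ] _), ?_⟩, ?_⟩
  · intro u hu
    -- The quadratic term is subtracted and added back because moving a fraction t towards `u` costs
    -- an error t times that term, which must take the shape a + (1 - t) c.
    have key : ω x + (-(2 * K) * inner ℝ (A (x - y)) (A (u - x)) - K * ‖A (u - x)‖ ^ 2)
        + K * ‖A (u - x)‖ ^ 2 ≤ ω u := by
      refine le_of_forall_one_sub_mul_le fun t ht0 ht1 => ?_
      have h1 := hω.2 hx hu (sub_nonneg.2 ht1.le) ht0.le (by ring)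
      have h2 : ω x + K * ‖A (x - y)‖ ^ 2 ≤ ω ((1 - t) • x + t • u)
          + K * ‖A ((1 - t) • x + t • u - y)‖ ^ 2 :=
        hxmin (hω.1 hx hu (sub_nonneg.2 ht1.le) ht0.le (by ring))
      have h3 : (1 - t) • x + t • u - y = (x - y) + t • (u - x) := by
        rw [sub_smul, one_smul, smul_sub]; abel
      rw [h3, map_add, map_smul, norm_add_sq_real, inner_smul_right, norm_smul, mul_pow,
        Real.norm_eq_abs, sq_abs] at h2
      simp only [smul_eq_mul] at h1
      refine le_of_mul_le_mul_left (a := t) ?_ ht0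
      nlinarith
    change ω x + -(2 * K) * inner ℝ (A (x - y)) (A (u - x)) ≤ ω u
    linarith
  · have h1 : ω x + K * ‖A (x - y)‖ ^ 2 ≤ ω y + K * ‖A (y - y)‖ ^ 2 := hxmin hy
    have h2 : ω b ≤ ω x := hbmin hx
    have h3 : ‖x - y‖ ≤ ‖(A.symm : EuclideanSpace ℝ (Fin (Module.finrank ℝ E)) →L[ℝ] E)‖ * ‖A (x - y)‖ := by
      simpa using (A.symm : EuclideanSpace ℝ (Fin (Module.finrank ℝ E)) →L[ℝ] E).le_opNorm (A (x - y))
    simp only [sub_self, map_zero, norm_zero] at h1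
    have h4 : (c / r * ‖A (x - y)‖) ^ 2 < 1 := by
      have h5 : (ω y - ω b + 1) * (c / r * ‖A (x - y)‖) ^ 2 = K * ‖A (x - y)‖ ^ 2 := by
        simp only [K]; ring
      by_contra! h
      nlinarith
    have h6 : c / r * ‖A (x - y)‖ < 1 := by
      have := (sq_lt_one_iff_abs_lt_one _).1 h4
      exact (le_abs_self _).trans_lt this
    have h7 : c * ‖A (x - y)‖ < r := by
      rw [div_mul_eq_mul_div, div_lt_one hr] at h6
      exact h6
    have h8 : ‖(A.symm : EuclideanSpace ℝ (Fin (Module.finrank ℝ E)) →L[ℝ] E)‖ * ‖A (x - y)‖ ≤ c * ‖A (x - y)‖ := by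
      gcongr; simp [c]
    linarith

variable {ω' : E → E →L[ℝ] ℝ}

/-- The selected subgradient is extremal: against any other subgradient it satisfies the
variational inequality over the whole domain. -/
theorem IsDistanceGenerating.sub_apply_nonneg [FiniteDimensional ℝ E]
    (h : IsDistanceGenerating Θ ω ω') (hΘ : IsCompact Θ) {x u : E} {s : E →L[ℝ] ℝ}
    (hx : x ∈ Θ) (hs : s ∈ subdiff Θ ω x) (hu : u ∈ Θ) : 0 ≤ (ω' x - s) (u - x) := by
  have hconv : ConvexOn ℝ Θ ω := h.strongConvexOn.convexOn fun r => by simp; positivity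
  let t : ℕ → ℝ := fun k => 1 / ((k : ℝ) + 1)
  have ht0 : ∀ k, 0 < t k := fun k => by positivity
  have ht1 : ∀ k, t k ≤ 1 := fun k => by
    simp only [t]; rw [div_le_one (by positivity)]; linarith [(Nat.cast_nonneg k : (0 : ℝ) ≤ k)]
  have htlim : Filter.Tendsto t Filter.atTop (nhds 0) := tendsto_one_div_add_atTop_nhds_zero_nat
  -- The segment from `x` to `u` may leave the domain of the subdifferential, so it is followed by
  -- nearby points of that domain. The error t², being o(t), leaves the limiting direction equal to
  -- `u - x`.
  have hex : ∀ k, ∃ y ∈ subdiffDomain Θ ω, ‖y - (x + t k • (u - x))‖ < t k ^ 2 := fun k =>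
    exists_mem_subdiffDomain_norm_sub_lt hΘ h.continuousOn hconv
      (hconv.1.add_smul_sub_mem hx hu ⟨(ht0 k).le, ht1 k⟩) (pow_pos (ht0 k) 2)
  choose y hyd hy using hex
  have hdir : Filter.Tendsto (fun k => (t k)⁻¹ • (y k - x)) Filter.atTop (nhds (u - x)) := by
    rw [tendsto_iff_norm_sub_tendsto_zero]
    refine squeeze_zero (fun _ => norm_nonneg _) (fun k => ?_) htlim
    have : (t k)⁻¹ • (y k - x) - (u - x) = (t k)⁻¹ • (y k - (x + t k • (u - x))) := by
      rw [← sub_sub, smul_sub _ (y k - x), smul_smul, inv_mul_cancel₀ (ht0 k).ne', one_smul]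
    rw [this, norm_smul, norm_inv, Real.norm_of_nonneg (ht0 k).le, inv_mul_le_iff₀ (ht0 k)]
    linarith [hy k, sq (t k)]
  have hylim : Filter.Tendsto y Filter.atTop (nhds x) := by
    have h1 := (htlim.smul hdir).add_const x
    simp only [zero_smul, zero_add] at h1
    refine h1.congr fun k => ?_
    rw [smul_smul, mul_inv_cancel₀ (ht0 k).ne', one_smul, sub_add_cancel]
  have hω' : Filter.Tendsto (fun k => ω' (y k)) Filter.atTop (nhds (ω' x)) :=
    (h.continuousOn_selection x ⟨hx, s, hs⟩).tendsto.comp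
      (tendsto_nhdsWithin_iff.2 ⟨hylim, Filter.Eventually.of_forall hyd⟩)
  have hlim : Filter.Tendsto (fun k => (ω' (y k) - s) ((t k)⁻¹ • (y k - x))) Filter.atTop
      (nhds ((ω' x - s) (u - x))) := 
    ((isBoundedBilinearMap_apply (𝕜 := ℝ) (E := E) (F := ℝ)).continuous.tendsto
      (ω' x - s, u - x)).comp ((hω'.sub (tendsto_const_nhds (x := s))).prodMk_nhds hdir)
  -- Monotonicity between `ω' (y k)` and `s` gives the sign at each `k`; continuity of the selection
  -- carries it to the limit.
  refine ge_of_tendsto' hlim fun k => ?_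
  have h1 := h.strongConvexOn.sq_norm_sub_le (hyd k).1 hx (h.mem_subdiff _ (hyd k)) hs
  rw [map_smul, smul_eq_mul]
  exact mul_nonneg (inv_nonneg.2 (ht0 k).le) ((sq_nonneg _).trans h1)

theorem IsDistanceGenerating.half_sq_le_bregman (h : IsDistanceGenerating Θ ω ω') {x u : E}
    (hx : x ∈ subdiffDomain Θ ω) (hu : u ∈ Θ) : ‖u - x‖ ^ 2 / 2 ≤ bregman ω ω' x u := by
  have := h.strongConvexOn.add_half_sq_le hx.1 (h.mem_subdiff _ hx) hu
  rw [bregman]; linarith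

theorem center_mem (hΘ : IsCompact Θ) (hne : Θ.Nonempty) (hc : ContinuousOn ω Θ) :
    center Θ ω ∈ subdiffDomain Θ ω := by
  have h := proxPoint_spec hΘ hne hc 0
  have hmin : IsMinOn ω (subdiffDomain Θ ω) (proxPoint Θ ω 0) := fun u hu => by
    simpa using h.2 u hu.1
  have hex : ∃ x ∈ subdiffDomain Θ ω, IsMinOn ω (subdiffDomain Θ ω) x :=
    ⟨_, ⟨h.1, 0, h.2⟩, hmin⟩
  exact (argminOn_spec hex).1

theorem IsDistanceGenerating.bregman_center_le (h : IsDistanceGenerating Θ ω ω')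
    (hΘ : IsCompact Θ) {u : E} (hu : u ∈ Θ) :
    bregman ω ω' (center Θ ω) u ≤ bregmanRadius Θ ω ω' := by
  refine le_csSup (hΘ.bddAbove_image ?_) (mem_image_of_mem _ hu)
  exact (h.continuousOn.sub continuousOn_const).sub (Continuous.continuousOn (by fun_prop))

theorem IsDistanceGenerating.half_sq_norm_sub_center_le (h : IsDistanceGenerating Θ ω ω')
    (hΘ : IsCompact Θ) {u : E} (hu : u ∈ Θ) :
    ‖u - center Θ ω‖ ^ 2 / 2 ≤ bregmanRadius Θ ω ω' :=
  (h.half_sq_le_bregman (center_mem hΘ ⟨u, hu⟩ h.continuousOn) hu).trans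
    (h.bregman_center_le hΘ hu)

theorem IsDistanceGenerating.bregmanRadius_nonneg (h : IsDistanceGenerating Θ ω ω')
    (hΘ : IsCompact Θ) (hne : Θ.Nonempty) : 0 ≤ bregmanRadius Θ ω ω' := by
  obtain ⟨u, hu⟩ := hne
  exact (by positivity : (0 : ℝ) ≤ _).trans (h.half_sq_norm_sub_center_le hΘ hu)

theorem IsDistanceGenerating.norm_sub_le_sqrt (h : IsDistanceGenerating Θ ω ω')
    (hΘ : IsCompact Θ) {u v : E} (hu : u ∈ Θ) (hv : v ∈ Θ) :
    ‖u - v‖ ≤ 2 * √(2 * bregmanRadius Θ ω ω') := by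
  have h1 : ∀ {u}, u ∈ Θ → ‖u - center Θ ω‖ ≤ √(2 * bregmanRadius Θ ω ω') := fun hu =>
    Real.le_sqrt_of_sq_le (by linarith [h.half_sq_norm_sub_center_le hΘ hu])
  calc ‖u - v‖ = ‖(u - center Θ ω) - (v - center Θ ω)‖ := by rw [sub_sub_sub_cancel_right]
    _ ≤ _ := norm_sub_le _ _
    _ ≤ _ := by linarith [h1 hu, h1 hv]

/-- Up to constants, the mirror descent objective is ω minus the linear form ω'(θ) - ηg. Strong
convexity makes the minimizer unique, so the arbitrary choice in `argminOn` is harmless and the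
update is a Lipschitz function of that form. -/
theorem mirrorDescent_update_eq (hΘ : IsCompact Θ) (h : IsDistanceGenerating Θ ω ω') {θ : E}
    (hθ : θ ∈ Θ) (η : ℝ) (g : E →L[ℝ] ℝ) :
    (mirrorDescent Θ ω ω' η).update θ g = proxPoint Θ ω (ω' θ - η • g) := by
  have hc : ContinuousOn (fun u => η * g u + bregman ω ω' θ u) Θ :=
    ContinuousOn.add (Continuous.continuousOn (by fun_prop))
      ((h.continuousOn.sub continuousOn_const).sub (Continuous.continuousOn (by fun_prop)))
  have h1 := argminOn_spec_of_isCompact hΘ ⟨θ, hθ⟩ hc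
  refine h.strongConvexOn.proxPoint_eq hΘ h.continuousOn h1.1 fun u hu => ?_
  change ω (argminOn _ Θ) + _ ≤ _
  set y := argminOn (fun u => η * g u + bregman ω ω' θ u) Θ
  have h2 : η * g y + bregman ω ω' θ y ≤ η * g u + bregman ω ω' θ u := h1.2 hu
  simp only [bregman, map_sub] at h2
  change ω y + (ω' θ - η • g) (u - y) ≤ ω u
  simp only [ sub_apply, smul_apply,
    smul_eq_mul, map_sub]
  linarith

theorem mirrorDescent_update_mem (hΘ : IsCompact Θ) (h : IsDistanceGenerating Θ ω ω') {θ : E}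
    (hθ : θ ∈ Θ) (η : ℝ) (g : E →L[ℝ] ℝ) :
    (mirrorDescent Θ ω ω' η).update θ g ∈ subdiffDomain Θ ω := by
  rw [mirrorDescent_update_eq hΘ h hθ]
  have := proxPoint_spec hΘ ⟨θ, hθ⟩ h.continuousOn (ω' θ - η • g)
  exact ⟨this.1, _, this.2⟩

/-- The three-point identity for V, with `sub_apply_nonneg` in place of the usual optimality
condition. The leftover η⟨g, θ - y⟩ - V(θ, y) is at most ηd - d²/2 ≤ η²/2, where d = ‖y - θ‖. -/
theorem bregman_mirrorDescent_update_le [FiniteDimensional ℝ E] (hΘ : IsCompact Θ)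
    (h : IsDistanceGenerating Θ ω ω') {θ u : E} (hθ : θ ∈ subdiffDomain Θ ω) (hu : u ∈ Θ)
    {η : ℝ} {g : E →L[ℝ] ℝ} (hη : 0 ≤ η) (hg : ‖g‖ ≤ 1) :
    bregman ω ω' ((mirrorDescent Θ ω ω' η).update θ g) u
      ≤ bregman ω ω' θ u - η * g (θ - u) + η ^ 2 / 2 := by
  rw [mirrorDescent_update_eq hΘ h hθ.1]
  have hp := proxPoint_spec hΘ ⟨u, hu⟩ h.continuousOn (ω' θ - η • g)
  set y := proxPoint Θ ω (ω' θ - η • g)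
  have h1 := h.sub_apply_nonneg hΘ hp.1 hp.2 hu
  have h2 := h.half_sq_le_bregman hθ hp.1
  have h3 : g (θ - y) ≤ ‖y - θ‖ := by
    rw [norm_sub_rev]
    exact (le_abs_self _).trans (g.le_of_opNorm_le hg _ |>.trans (by rw [one_mul]))
  have h4 : η * g (θ - y) ≤ η * ‖y - θ‖ := mul_le_mul_of_nonneg_left h3 hη
  simp only [bregman, map_sub, sub_apply, smul_apply,
    smul_eq_mul] at *
  nlinarith [sq_nonneg (‖y - θ‖ - η)]

end ConvexAnalysis

/-! ### The auditor: Hedge potential and implicit exploration. -/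

section Hedge

theorem Real.exp_neg_le_one_sub_add_half_sq {y : ℝ} (hy : 0 ≤ y) :
    Real.exp (-y) ≤ 1 - y + y ^ 2 / 2 := by
  have h1 := Real.quadratic_le_exp_of_nonneg hy
  have h2 : 0 < 1 - y + y ^ 2 / 2 := by nlinarith [sq_nonneg (y - 1)]
  rw [Real.exp_neg]
  -- The claim reduces to (1 + y + y²/2)(1 - y + y²/2) = 1 + y⁴/4 ≥ 1.
  refine inv_le_of_inv_le₀ h2 (le_trans ?_ h1)
  rw [inv_le_iff_one_le_mul₀ h2]
  nlinarith [pow_nonneg hy 4]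

theorem Real.exp_neg_le_one_sub_add_sq {y : ℝ} (hy : |y| ≤ 1) :
    Real.exp (-y) ≤ 1 - y + y ^ 2 := by
  have := (abs_le.1 (Real.abs_exp_sub_one_sub_id_le (x := -y) (by rwa [abs_neg]))).2
  rw [neg_sq] at this
  linarith

/-- The implicit exploration inequality. -/
theorem Real.exp_div_add_half_le {a x w η : ℝ} (ha : 0 ≤ a) (haη : a ≤ η) (hx : x ∈ Icc (0 : ℝ) 1)
    (hw : 0 < w) : Real.exp (a * (x / (w + η / 2))) ≤ 1 + a * (x / w) := by
  have h0 : 0 ≤ a * x := mul_nonneg ha hx.1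
  have h1 : 0 ≤ a * (x / w) := mul_nonneg ha (div_nonneg hx.1 hw.le)
  -- After taking logarithms, use log(1 + y) ≥ 2y/(y + 2) at y = ax/w. The result is ax/(w + ax/2),
  -- and ax ≤ η compares it with the biased estimate.
  rw [← Real.le_log_iff_exp_le (by linarith)]
  refine le_trans ?_ (Real.le_log_one_add_of_nonneg h1)
  have h2 : 2 * (a * (x / w)) / (a * (x / w) + 2) = a * x / (w + a * x / 2) := by
    field_simp
    ring
  rw [h2, ← mul_div_assoc]
  have h3 : a * x ≤ η := (mul_le_of_le_one_right ha hx.2).trans haη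
  gcongr

variable {n : ℕ} [NeZero n]

theorem hedge_pos (η : ℝ) (c : Fin n → ℝ) (i : Fin n) : 0 < (hedge η c).1 i :=
  div_pos (Real.exp_pos _) (Finset.sum_pos (fun _ _ => Real.exp_pos _) Finset.univ_nonempty)

/-- The estimated cost of the observed meta-action. -/
def ixEstimate (η : ℝ) (c : Fin n → ℝ) (k : Fin n) (x : ℝ) : ℝ := x / ((hedge η c).1 k + η / 2)

/-- The potential that tracks the regret of the auditor against the fixed meta-action `j`. -/
def hedgePotential (η : ℝ) (j : Fin n) (c : Fin n → ℝ) : ℝ :=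
  Real.log (∑ i, Real.exp (-η * c i)) / η + c j

omit [NeZero n] in
theorem hedgePotential_zero (η : ℝ) (j : Fin n) :
    hedgePotential η j 0 = Real.log n / η := by
  simp [hedgePotential]

omit [NeZero n] in
theorem hedgePotential_nonneg {η : ℝ} (hη : 0 < η) (j : Fin n) (c : Fin n → ℝ) :
    0 ≤ hedgePotential η j c := by
  have h1 : Real.exp (-η * c j) ≤ ∑ i, Real.exp (-η * c i) :=
    Finset.single_le_sum (f := fun i => Real.exp (-η * c i)) (fun _ _ => (Real.exp_pos _).le)
      (Finset.mem_univ j)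
  have h2 := (Real.le_log_iff_exp_le ((Real.exp_pos _).trans_le h1)).2 h1
  have h3 : -c j ≤ Real.log (∑ i, Real.exp (-η * c i)) / η := by
    rw [le_div_iff₀ hη]; linarith
  rw [hedgePotential]; linarith

/-- Writing e for the estimated cost, the loss term ηe has two halves: one is the bias in we = x -
ηe/2, the other the second-order term of Hedge, bounded using we ≤ 1. -/
theorem hedgePotential_update_le {η x : ℝ} (hη : 0 < η) (hx : x ∈ Icc (0 : ℝ) 1) (j k : Fin n)
    (c : Fin n → ℝ) :
    hedgePotential η j ((exp3IX n η (η / 2)).update c (k, x)) ≤ hedgePotential η j c - x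
      + (η + if k = j then 1 else 0) * ixEstimate η c k x := by
  set e := ixEstimate η c k x with he
  set w := (hedge η c).1 k with hw
  set S := ∑ i, Real.exp (-η * c i) with hS
  have hw0 : 0 < w := hedge_pos η c k
  have hS0 : 0 < S := Finset.sum_pos (fun _ _ => Real.exp_pos _) Finset.univ_nonempty
  have hden : 0 < w + η / 2 := by positivity
  have he0 : 0 ≤ e := div_nonneg hx.1 hden.le
  have hwe : w * e = x - η / 2 * e := by
    have : (w + η / 2) * e = x := mul_div_cancel₀ _ hden.ne'
    linarith
  have hwe1 : w * e ≤ 1 := by nlinarith [hx.2]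
  have hup : (exp3IX n η (η / 2)).update c (k, x) = c + Pi.single k e := rfl
  have hsum : ∑ i, Real.exp (-η * (c + Pi.single k e : Fin n → ℝ) i)
      = S * (1 - w * (1 - Real.exp (-(η * e)))) := by
    have h1 : S * w = Real.exp (-η * c k) := mul_div_cancel₀ _ hS0.ne'
    have h2 : ∑ i, (Real.exp (-η * (c + Pi.single k e : Fin n → ℝ) i) - Real.exp (-η * c i))
        = Real.exp (-η * (c k + e)) - Real.exp (-η * c k) := by
      rw [Finset.sum_eq_single k]
      · simp
      · intro i _ hi; simp [hi]
      · simp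
    rw [Finset.sum_sub_distrib, sub_eq_iff_eq_add] at h2
    rw [h2, mul_add, Real.exp_add, ← neg_mul, ← h1, ← hS]
    ring
  have hpos : 0 < 1 - w * (1 - Real.exp (-(η * e))) := by
    have : 0 < ∑ i, Real.exp (-η * (c + Pi.single k e : Fin n → ℝ) i) :=
      Finset.sum_pos (fun _ _ => Real.exp_pos _) Finset.univ_nonempty
    rw [hsum] at this
    exact pos_of_mul_pos_right this hS0.le
  have hlog := Real.log_le_sub_one_of_pos hpos
  have hexp := Real.exp_neg_le_one_sub_add_half_sq (mul_nonneg hη.le he0)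
  have hmain : Real.log (1 - w * (1 - Real.exp (-(η * e)))) ≤ η * (-x + η * e) := by
    have h1 : w * Real.exp (-(η * e)) ≤ w * (1 - η * e + (η * e) ^ 2 / 2) :=
      mul_le_mul_of_nonneg_left hexp hw0.le
    have h2 : w * ((η * e) ^ 2 / 2) = η ^ 2 * e / 2 * (w * e) := by ring
    have h3 : η ^ 2 * e / 2 * (w * e) ≤ η ^ 2 * e / 2 * 1 :=
      mul_le_mul_of_nonneg_left hwe1 (by positivity)
    have h4 : w * (η * e) = η * (x - η / 2 * e) := by rw [← hwe]; ring
    nlinarith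
  have hdiv : Real.log (1 - w * (1 - Real.exp (-(η * e)))) / η ≤ -x + η * e := by
    rw [div_le_iff₀ hη]; linarith
  rw [hup, hedgePotential, hsum, Real.log_mul hS0.ne' hpos.ne', add_div, hedgePotential, ← hS]
  have hj : (c + Pi.single k e : Fin n → ℝ) j = c j + (if k = j then 1 else 0) * e := by
    by_cases h : k = j
    · subst h; simp
    · simp [h]
  rw [hj]
  linarith

/-- The exponential of the biased estimate is bounded affinely in the unbiased ratio x/w, whose
expectation is exact. The condition `lam * (η + 1) ≤ η` is what implicit exploration requires when k
= j. -/
theorem exp_hedgePotential_update_le {η lam x : ℝ} (hη : 0 < η) (hlam : 0 ≤ lam) (hlam1 : lam ≤ 1)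
    (hlamη : lam * (η + 1) ≤ η) (hx : x ∈ Icc (0 : ℝ) 1) (j k : Fin n) (c : Fin n → ℝ) :
    Real.exp (lam * hedgePotential η j ((exp3IX n η (η / 2)).update c (k, x)))
      ≤ Real.exp (lam * hedgePotential η j c) * (1 - lam * x + lam ^ 2
        + lam * (η + if k = j then 1 else 0) * (x / (hedge η c).1 k)) := by
  have h1 := mul_le_mul_of_nonneg_left (hedgePotential_update_le hη hx j k c) hlam
  set b : ℝ := if k = j then 1 else 0 with hb
  have hb0 : 0 ≤ b := by rw [hb]; split_ifs <;> norm_num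
  have hb1 : b ≤ 1 := by rw [hb]; split_ifs <;> norm_num
  have ha0 : 0 ≤ lam * (η + b) := by positivity
  have ha : lam * (η + b) ≤ η := le_trans (by gcongr) hlamη
  have hy0 : 0 ≤ lam * x := mul_nonneg hlam hx.1
  have hy1 : lam * x ≤ 1 := mul_le_one₀ hlam1 hx.1 hx.2
  have hylam : lam * x ≤ lam := mul_le_of_le_one_right hlam hx.2
  have h2 := Real.exp_neg_le_one_sub_add_sq (y := lam * x) (by rwa [abs_of_nonneg hy0])
  have h3 := Real.exp_div_add_half_le ha0 ha hx (hedge_pos η c k)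
  have h4 : 0 ≤ lam * (η + b) * (x / (hedge η c).1 k) :=
    mul_nonneg ha0 (div_nonneg hx.1 (hedge_pos η c k).le)
  set y := lam * x
  set q := lam * (η + b) * (x / (hedge η c).1 k)
  calc _ ≤ Real.exp (lam * hedgePotential η j c + (-y + lam * (η + b) * ixEstimate η c k x)) := by
        refine Real.exp_le_exp.2 (h1.trans (le_of_eq ?_))
        simp only [y]; ring
    _ = Real.exp (lam * hedgePotential η j c)
        * (Real.exp (-y) * Real.exp (lam * (η + b) * ixEstimate η c k x)) := by
        rw [Real.exp_add, Real.exp_add]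
    _ ≤ _ := by
        refine mul_le_mul_of_nonneg_left ?_ (Real.exp_pos _).le
        have h5 : 0 ≤ 1 - y + y ^ 2 := by nlinarith
        calc _ ≤ (1 - y + y ^ 2) * (1 + q) := mul_le_mul h2 h3 (Real.exp_pos _).le h5
          _ ≤ 1 - y + lam ^ 2 + q := by
            have h6 : y ^ 2 ≤ lam ^ 2 := pow_le_pow_left₀ hy0 hylam 2
            have h7 : 0 ≤ q * y * (1 - y) := mul_nonneg (mul_nonneg h4 hy0) (sub_nonneg.2 hy1)
            linarith

theorem measurable_hedge (η : ℝ) (i : Fin n) :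
    Measurable fun c : Fin n → ℝ => (hedge η c).1 i := by
  simp only [hedge]
  fun_prop

end Hedge

/-! ### Laws of oracle algorithms: one draw followed by one query. -/

section OracleAlg

open OracleAlg

variable {n : ℕ} {Z α : Type*} [MeasurableSpace Z] [MeasurableSpace α] {D : Fin n → Measure Z}

theorem OracleAlg.law_draw_query_apply (w : stdSimplex ℝ (Fin n)) {f : Fin n → Z → OracleAlg n Z α}
    (hf : ∀ i, Measurable fun z => law D (f i z)) {B : Set α} (hB : MeasurableSet B) :
    law D (.draw w fun i => .query i (f i)) B
      = ∑ i, ENNReal.ofReal (w.1 i) * ∫⁻ z, law D (f i z) B ∂D i := by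
  simp only [law, Measure.coe_finsetSum, Finset.sum_apply, Measure.smul_apply, smul_eq_mul]
  refine Finset.sum_congr rfl fun i _ => ?_
  rw [Measure.bind_apply hB (hf i).aemeasurable]

theorem OracleAlg.law_draw_query_eq_one [∀ i, IsProbabilityMeasure (D i)]
    (w : stdSimplex ℝ (Fin n)) {f : Fin n → Z → OracleAlg n Z α}
    (hf : ∀ i, Measurable fun z => law D (f i z)) {B : Set α} (hB : MeasurableSet B)
    (h1 : ∀ i z, law D (f i z) B = 1) :
    law D (.draw w fun i => .query i (f i)) B = 1 := by
  rw [law_draw_query_apply w hf hB]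
  simp only [h1, lintegral_const, measure_univ, mul_one]
  rw [← ENNReal.ofReal_sum_of_nonneg fun i _ => w.2.1 i, w.2.2, ENNReal.ofReal_one]

theorem OracleAlg.law_draw_query_le (w : stdSimplex ℝ (Fin n)) {f : Fin n → Z → OracleAlg n Z α}
    (hf : ∀ i, Measurable fun z => law D (f i z)) {B : Set α} (hB : MeasurableSet B)
    {g : Fin n → Z → ℝ} (hg0 : ∀ i z, 0 ≤ g i z) (hg : ∀ i, Integrable (g i) (D i))
    (h : ∀ i z, law D (f i z) B ≤ ENNReal.ofReal (g i z)) :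
    law D (.draw w fun i => .query i (f i)) B
      ≤ ENNReal.ofReal (∑ i, w.1 i * ∫ z, g i z ∂D i) := by
  rw [law_draw_query_apply w hf hB, ENNReal.ofReal_sum_of_nonneg fun i _ =>
    mul_nonneg (w.2.1 i) (integral_nonneg (hg0 i))]
  refine Finset.sum_le_sum fun i _ => ?_
  rw [ENNReal.ofReal_mul (w.2.1 i), ofReal_integral_eq_lintegral_ofReal (hg i)
    (Filter.Eventually.of_forall (hg0 i))]
  gcongr with z
  exact h i z

/-- `law_draw_query_apply` evaluates `Measure.bind` as an integral, which needs a measurable kernel.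
Measurability in the state must therefore be propagated through the recursion. -/
theorem OracleAlg.measurable_law_draw_query {X : Type*} [MeasurableSpace X] [∀ i, SFinite (D i)]
    {w : X → stdSimplex ℝ (Fin n)} (hw : ∀ i, Measurable fun x => (w x).1 i)
    {f : X → Fin n → Z → OracleAlg n Z α}
    (hf : ∀ i, Measurable fun p : X × Z => law D (f p.1 i p.2)) :
    Measurable fun x => law D (.draw (w x) fun i => .query i (f x i)) := by
  refine Measure.measurable_of_measurable_coe _ fun B hB => ?_
  have h : ∀ x, law D (.draw (w x) fun i => .query i (f x i)) B
      = ∑ i, ENNReal.ofReal ((w x).1 i) * ∫⁻ z, law D (f x i z) B ∂D i := fun x =>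
    law_draw_query_apply (w x) (fun i => (hf i).comp measurable_prodMk_left) hB
  simp only [h]
  refine Finset.measurable_fun_sum _ fun i _ => (hw i).ennreal_ofReal.mul ?_
  exact Measurable.lintegral_prod_right' (f := fun p : X × Z => law D (f p.1 i p.2) B)
    ((Measure.measurable_coe hB).comp (hf i))

end OracleAlg

/-! ### Risks of a smooth convex problem, call count and running averages. -/

namespace GroupDRO

variable {n : ℕ} {E Z H : Type*} [NormedAddCommGroup E] [NormedSpace ℝ E] [MeasurableSpace Z]
  {P : GroupDRO n E Z H}

theorem mem_epsOptimal [NeZero n] {ε : ℝ} {x : E} (hx : x ∈ P.params)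
    (h : ∀ i, P.risk i (P.model x) ≤ P.opt + ε) : x ∈ P.epsOptimal ε :=
  ⟨hx, ciSup_le h⟩

theorem callsAtMost_recipeLoop {S R : Type*} (P : GroupDRO n E Z H)
    (L : OnlineAlg S (E →L[ℝ] ℝ) E) (A : OnlineAlg R (Fin n × ℝ) (stdSimplex ℝ (Fin n))) (T m : ℕ)
    (s : S) (r : R) (a : E) : (P.recipeLoop L A T m s r a).CallsAtMost (2 * m) := by
  induction m generalizing s r a with
  | zero => trivial
  | succ m ih => exact fun i z k z' => ih _ _ _

theorem recipeLoop_mirrorDescent_succ [NeZero n] (P : GroupDRO n E Z H) (ω : E → ℝ) (ω' : E → E →L[ℝ] ℝ)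
    (ηL η γ : ℝ) (T m : ℕ) (s : E) (r : Fin n → ℝ) (a : E) :
    P.recipeLoop (mirrorDescent P.params ω ω' ηL) (exp3IX n η γ) T (m + 1) s r a
      = .draw (hedge η r) fun i => .query i fun z =>
        .draw (hedge η r) fun k => .query k fun z' =>
          P.recipeLoop (mirrorDescent P.params ω ω' ηL) (exp3IX n η γ) T m
            ((mirrorDescent P.params ω ω' ηL).update s (P.grad s z))
            ((exp3IX n η γ).update r (k, 1 - P.loss (P.model s) z'))
            (a + (mirrorDescent P.params ω ω' ηL).update s (P.grad s z)) :=
  rfl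

variable [MeasurableSpace E]

namespace IsSmoothConvex

theorem measurable_loss_right (hP : P.IsSmoothConvex) {θ : E} (hθ : θ ∈ P.params) :
    Measurable fun z => P.loss (P.model θ) z :=
  hP.measurable_loss.comp (measurable_prodMk_left (x := (⟨θ, hθ⟩ : P.params)))

theorem integrable_loss (hP : P.IsSmoothConvex) {θ : E} (hθ : θ ∈ P.params) (i : Fin n) :
    Integrable (fun z => P.loss (P.model θ) z) (P.dist i) :=
  have := hP.isProbabilityMeasure i
  Integrable.of_mem_Icc 0 1 (hP.measurable_loss_right hθ).aemeasurable
    (Filter.Eventually.of_forall (hP.loss_mem θ hθ))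

theorem risk_mem (hP : P.IsSmoothConvex) {θ : E} (hθ : θ ∈ P.params) (i : Fin n) :
    P.risk i (P.model θ) ∈ Icc (0 : ℝ) 1 := by
  have := hP.isProbabilityMeasure i
  refine ⟨integral_nonneg fun z => (hP.loss_mem θ hθ z).1, ?_⟩
  calc P.risk i (P.model θ) ≤ ∫ _, 1 ∂P.dist i :=
        integral_mono (hP.integrable_loss hθ i) (integrable_const 1) fun z =>
          (hP.loss_mem θ hθ z).2
    _ = 1 := by simp

theorem loss_sub_le_grad (hP : P.IsSmoothConvex) {θ u : E} (hθ : θ ∈ P.params)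
    (hu : u ∈ P.params) (z : Z) :
    P.loss (P.model θ) z - P.loss (P.model u) z ≤ P.grad θ z (θ - u) := by
  have h := (hP.convexOn z).add_fderivWithin_le hθ hu (hP.hasGrad θ hθ z)
  rw [← neg_sub θ u, map_neg] at h
  linarith

theorem loss_sub_le_norm (hP : P.IsSmoothConvex) {θ u : E} (hθ : θ ∈ P.params)
    (hu : u ∈ P.params) (z : Z) :
    P.loss (P.model θ) z - P.loss (P.model u) z ≤ ‖θ - u‖ := by
  refine (hP.loss_sub_le_grad hθ hu z).trans ((le_abs_self _).trans ?_)
  simpa using (P.grad θ z).le_of_opNorm_le (hP.norm_grad_le θ hθ z) (θ - u)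

theorem risk_sub_le_norm (hP : P.IsSmoothConvex) {θ u : E} (hθ : θ ∈ P.params)
    (hu : u ∈ P.params) (i : Fin n) :
    P.risk i (P.model θ) - P.risk i (P.model u) ≤ ‖θ - u‖ := by
  have := hP.isProbabilityMeasure i
  rw [risk, risk, ← integral_sub (hP.integrable_loss hθ i) (hP.integrable_loss hu i)]
  calc _ ≤ ∫ _, ‖θ - u‖ ∂P.dist i :=
        integral_mono ((hP.integrable_loss hθ i).sub (hP.integrable_loss hu i))
          (integrable_const _) fun z => hP.loss_sub_le_norm hθ hu z
    _ = _ := by simp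

theorem continuousOn_risk (hP : P.IsSmoothConvex) (i : Fin n) :
    ContinuousOn (fun θ => P.risk i (P.model θ)) P.params := by
  refine LipschitzOnWith.continuousOn (K := 1) (LipschitzOnWith.of_dist_le_mul fun θ hθ u hu => ?_)
  rw [Real.dist_eq, NNReal.coe_one, one_mul, dist_eq_norm, abs_le]
  have h1 := hP.risk_sub_le_norm hθ hu i
  have h2 := hP.risk_sub_le_norm hu hθ i
  rw [norm_sub_rev] at h2
  constructor <;> linarith

theorem convexOn_risk (hP : P.IsSmoothConvex) (i : Fin n) :
    ConvexOn ℝ P.params fun θ => P.risk i (P.model θ) := by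
  refine ⟨hP.convex, fun x hx y hy a b ha hb hab => ?_⟩
  simp only [risk, smul_eq_mul]
  rw [← integral_const_mul, ← integral_const_mul,
    ← integral_add ((hP.integrable_loss hx i).const_mul a) ((hP.integrable_loss hy i).const_mul b)]
  exact integral_mono (hP.integrable_loss (hP.convex hx hy ha hb hab) i)
    (((hP.integrable_loss hx i).const_mul a).add ((hP.integrable_loss hy i).const_mul b))
    fun z => (hP.convexOn z).2 hx hy ha hb hab

theorem continuousOn_worstRisk [NeZero n] (hP : P.IsSmoothConvex) :
    ContinuousOn (fun θ => P.worstRisk (P.model θ)) P.params := by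
  have h : (fun θ => P.worstRisk (P.model θ)) = fun θ =>
      Finset.univ.sup' Finset.univ_nonempty fun i => P.risk i (P.model θ) := by
    funext θ
    rw [worstRisk, Finset.sup'_univ_eq_ciSup]
  rw [h]
  exact ContinuousOn.finset_sup'_apply _ fun i _ => hP.continuousOn_risk i

/-- The optimal value is attained. -/
theorem exists_risk_le_opt [NeZero n] (hP : P.IsSmoothConvex) :
    ∃ u ∈ P.params, ∀ i, P.risk i (P.model u) ≤ P.opt := by
  obtain ⟨u, hu, hmin⟩ := hP.isCompact.exists_isMinOn hP.nonempty hP.continuousOn_worstRisk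
  refine ⟨u, hu, fun i => ?_⟩
  refine (le_ciSup (f := fun i => P.risk i (P.model u)) (finite_range _).bddAbove i).trans ?_
  refine le_csInf (hP.nonempty.image _) ?_
  rintro _ ⟨θ, hθ, rfl⟩
  exact hmin hθ

/-- Jensen's inequality one iterate at a time, matching a recursion that carries the running sum. -/
theorem average_mem (hP : P.IsSmoothConvex) {t : ℝ} (ht : 0 < t) {a θ : E}
    (ha : t⁻¹ • a ∈ P.params) (hθ : θ ∈ P.params) : (t + 1)⁻¹ • (a + θ) ∈ P.params ∧
    ∀ i, (t + 1) * P.risk i (P.model ((t + 1)⁻¹ • (a + θ)))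
      ≤ t * P.risk i (P.model (t⁻¹ • a)) + P.risk i (P.model θ) := by
  have h1 : (t + 1)⁻¹ • (a + θ) = (t / (t + 1)) • (t⁻¹ • a) + (1 / (t + 1)) • θ := by
    rw [smul_smul, smul_add]
    congr 2 <;> field_simp
  have ht1 : 0 < t + 1 := by linarith
  have h0 : t / (t + 1) + 1 / (t + 1) = 1 := by field_simp
  have ha0 : 0 ≤ t / (t + 1) := by positivity
  have hb0 : 0 ≤ 1 / (t + 1) := by positivity
  rw [h1]
  refine ⟨hP.convex ha hθ ha0 hb0 h0, fun i => ?_⟩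
  have h := mul_le_mul_of_nonneg_left ((hP.convexOn_risk i).2 ha hθ ha0 hb0 h0) ht1.le
  refine h.trans (le_of_eq ?_)
  simp only [smul_eq_mul]
  field_simp

end IsSmoothConvex

/-! ### The learner's potential, and measurability of the recipe in its state. -/

section Recipe

variable {ω : E → ℝ} {ω' : E → E →L[ℝ] ℝ}

/-- The learner's step, as a decrease of its potential. -/
theorem bregman_div_update_le [FiniteDimensional ℝ E] (hP : P.IsSmoothConvex)
    (hω : IsDistanceGenerating P.params ω ω') {T : ℕ} (hT : 0 < T) {u θ : E} (hu : u ∈ P.params)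
    (hθ : θ ∈ subdiffDomain P.params ω) (z : Z) {η : ℝ}
    (hη : η = √(2 * bregmanRadius P.params ω ω' / T)) :
    bregman ω ω' ((mirrorDescent P.params ω ω' η).update θ (P.grad θ z)) u / η
      ≤ bregman ω ω' θ u / η - (P.loss (P.model θ) z - P.loss (P.model u) z) + η / 2 := by
  have hη0 : 0 ≤ η := hη ▸ Real.sqrt_nonneg _
  rcases hη0.eq_or_lt with h0 | h0
  -- A zero step size means a zero Bregman radius, so the parameter space is a single point, θ = u,
  -- and division by zero returns 0.
  · have hD0 := hω.bregmanRadius_nonneg hP.isCompact hP.nonempty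
    have hT' : (0 : ℝ) < T := Nat.cast_pos.2 hT
    have h1 : 2 * bregmanRadius P.params ω ω' / T = 0 :=
      (Real.sqrt_eq_zero (by positivity)).1 (by rw [← hη, ← h0])
    have h2 : 2 * bregmanRadius P.params ω ω' = 0 := (div_eq_zero_iff.1 h1).resolve_right hT'.ne'
    have h3 := hω.norm_sub_le_sqrt hP.isCompact hθ.1 hu
    rw [h2, Real.sqrt_zero, mul_zero, norm_le_zero_iff, sub_eq_zero] at h3
    simp [← h0, h3]
  · have h1 := bregman_mirrorDescent_update_le hP.isCompact hω hθ hu h0.le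
      (hP.norm_grad_le θ hθ.1 z)
    have h2 := mul_le_mul_of_nonneg_left (hP.loss_sub_le_grad hθ.1 hu z) h0.le
    rw [div_le_iff₀ h0, add_mul, sub_mul, div_mul_cancel₀ _ h0.ne']
    linarith

variable [BorelSpace E] [FiniteDimensional ℝ E]

theorem measurable_mirrorDescent_update (hP : P.IsSmoothConvex)
    (hω : IsDistanceGenerating P.params ω ω') (η : ℝ) :
    Measurable fun q : subdiffDomain P.params ω × Z =>
      (⟨(mirrorDescent P.params ω ω' η).update q.1 (P.grad q.1 q.2),
        mirrorDescent_update_mem hP.isCompact hω q.1.2.1 η _⟩ : subdiffDomain P.params ω) := by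
  refine Measurable.subtype_mk ?_
  have h : (fun q : subdiffDomain P.params ω × Z =>
      (mirrorDescent P.params ω ω' η).update q.1 (P.grad q.1 q.2))
      = fun q => proxPoint P.params ω (ω' q.1 - η • P.grad q.1 q.2) :=
    funext fun q => mirrorDescent_update_eq hP.isCompact hω q.1.2.1 η _
  rw [h]
  have : SecondCountableTopology (E →L[ℝ] ℝ) := secondCountable_of_proper
  have h1 : Measurable fun q : subdiffDomain P.params ω × Z => ω' q.1 :=
    (continuousOn_iff_continuous_domRestrict.1 hω.continuousOn_selection).measurable.comp
      measurable_fst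
  have h2 : Measurable fun q : subdiffDomain P.params ω × Z => P.grad q.1 q.2 :=
    hP.measurable_grad.comp (((measurable_inclusion fun _ hx => hx.1).comp measurable_fst).prodMk
      measurable_snd)
  exact (lipschitzWith_proxPoint hP.isCompact hP.nonempty hω.continuousOn
    hω.strongConvexOn).continuous.measurable.comp (h1.sub (h2.const_smul η))

variable [NeZero n]

theorem measurable_law_recipeLoop_update_of (hP : P.IsSmoothConvex)
    (hω : IsDistanceGenerating P.params ω ω') {ηL η γ : ℝ} {T m : ℕ}
    (hm : Measurable fun p : subdiffDomain P.params ω × (Fin n → ℝ) × E =>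
      OracleAlg.law P.dist (P.recipeLoop (mirrorDescent P.params ω ω' ηL) (exp3IX n η γ) T m
        p.1 p.2.1 p.2.2)) (k : Fin n) :
    Measurable fun q : ((subdiffDomain P.params ω × (Fin n → ℝ) × E) × Z) × Z =>
      OracleAlg.law P.dist (P.recipeLoop (mirrorDescent P.params ω ω' ηL) (exp3IX n η γ) T m
        ((mirrorDescent P.params ω ω' ηL).update q.1.1.1 (P.grad q.1.1.1 q.1.2))
        ((exp3IX n η γ).update q.1.1.2.1 (k, 1 - P.loss (P.model q.1.1.1) q.2))
        (q.1.1.2.2 + (mirrorDescent P.params ω ω' ηL).update q.1.1.1 (P.grad q.1.1.1 q.1.2))) := by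
  have : SecondCountableTopology E := secondCountable_of_proper
  have hs := (measurable_mirrorDescent_update hP hω ηL).comp
    ((measurable_fst.fst.fst.prodMk measurable_fst.snd :
      Measurable fun q : ((subdiffDomain P.params ω × (Fin n → ℝ) × E) × Z) × Z =>
        (q.1.1.1, q.1.2)))
  have hx : Measurable fun q : ((subdiffDomain P.params ω × (Fin n → ℝ) × E) × Z) × Z =>
      P.loss (P.model q.1.1.1) q.2 :=
    hP.measurable_loss.comp (((measurable_inclusion fun _ hx => hx.1).comp
      measurable_fst.fst.fst).prodMk measurable_snd)
  have hc : Measurable fun q : ((subdiffDomain P.params ω × (Fin n → ℝ) × E) × Z) × Z =>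
      q.1.1.2.1 := measurable_fst.fst.snd.fst
  have ha : Measurable fun q : ((subdiffDomain P.params ω × (Fin n → ℝ) × E) × Z) × Z =>
      q.1.1.2.2 := measurable_fst.fst.snd.snd
  have hr : Measurable fun q : ((subdiffDomain P.params ω × (Fin n → ℝ) × E) × Z) × Z =>
      (exp3IX n η γ).update q.1.1.2.1 (k, 1 - P.loss (P.model q.1.1.1) q.2) := by
    refine hc.add (measurable_pi_lambda _ fun i => ?_)
    have hv : Measurable fun q : ((subdiffDomain P.params ω × (Fin n → ℝ) × E) × Z) × Z =>
        (1 - P.loss (P.model q.1.1.1) q.2) / ((hedge η q.1.1.2.1).1 k + γ) :=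
      (hx.const_sub 1).div (((measurable_hedge η k).comp hc).add_const γ)
    by_cases hik : i = k
    · subst hik; simpa using hv
    · simp [hik]
  exact hm.comp (hs.prodMk (hr.prodMk (ha.add hs.subtype_val)))

theorem measurable_law_recipeLoop_step_of (hP : P.IsSmoothConvex)
    (hω : IsDistanceGenerating P.params ω ω') {ηL η γ : ℝ} {T m : ℕ}
    (hm : Measurable fun p : subdiffDomain P.params ω × (Fin n → ℝ) × E =>
      OracleAlg.law P.dist (P.recipeLoop (mirrorDescent P.params ω ω' ηL) (exp3IX n η γ) T m
        p.1 p.2.1 p.2.2)) :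
    Measurable fun q : (subdiffDomain P.params ω × (Fin n → ℝ) × E) × Z =>
      OracleAlg.law P.dist (.draw (hedge η q.1.2.1) fun k => .query k fun z' =>
        P.recipeLoop (mirrorDescent P.params ω ω' ηL) (exp3IX n η γ) T m
        ((mirrorDescent P.params ω ω' ηL).update q.1.1 (P.grad q.1.1 q.2))
        ((exp3IX n η γ).update q.1.2.1 (k, 1 - P.loss (P.model q.1.1) z'))
        (q.1.2.2 + (mirrorDescent P.params ω ω' ηL).update q.1.1 (P.grad q.1.1 q.2))) :=
  have := hP.isProbabilityMeasure
  OracleAlg.measurable_law_draw_query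
    (fun i => (measurable_hedge η i).comp measurable_fst.snd.fst) fun k =>
      measurable_law_recipeLoop_update_of hP hω hm k

/-- The learner's state ranges over the subtype Θ°, since the selection ω' is continuous only there
and the losses and gradients are measurable only over the parameter space. -/
theorem measurable_law_recipeLoop (hP : P.IsSmoothConvex)
    (hω : IsDistanceGenerating P.params ω ω') (ηL η γ : ℝ) (T m : ℕ) :
    Measurable fun p : subdiffDomain P.params ω × (Fin n → ℝ) × E =>
      OracleAlg.law P.dist (P.recipeLoop (mirrorDescent P.params ω ω' ηL) (exp3IX n η γ) T m
        p.1 p.2.1 p.2.2) := by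
  have := hP.isProbabilityMeasure
  have : SecondCountableTopology E := secondCountable_of_proper
  induction m with
  | zero =>
    exact Measure.measurable_dirac.comp (measurable_snd.snd.const_smul _)
  | succ m ih =>
    exact OracleAlg.measurable_law_draw_query
      (fun i => (measurable_hedge η i).comp measurable_snd.fst) fun i =>
        measurable_law_recipeLoop_step_of hP hω ih

theorem measurable_law_recipeLoop_update (hP : P.IsSmoothConvex)
    (hω : IsDistanceGenerating P.params ω ω') (ηL η γ : ℝ) (T m : ℕ) {s : E}
    (hs : s ∈ subdiffDomain P.params ω) (r : Fin n → ℝ) (a : E) (z : Z) (k : Fin n) :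
    Measurable fun z' =>
      OracleAlg.law P.dist (P.recipeLoop (mirrorDescent P.params ω ω' ηL) (exp3IX n η γ) T m
        ((mirrorDescent P.params ω ω' ηL).update s (P.grad s z))
        ((exp3IX n η γ).update r (k, 1 - P.loss (P.model s) z'))
        (a + (mirrorDescent P.params ω ω' ηL).update s (P.grad s z))) :=
  have h := (measurable_law_recipeLoop_update_of hP hω
    (measurable_law_recipeLoop hP hω ηL η γ T m) k).comp
      (measurable_prodMk_left (x := (((⟨s, hs⟩ : subdiffDomain P.params ω), r, a), z)))
  h

theorem measurable_law_recipeLoop_step (hP : P.IsSmoothConvex)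
    (hω : IsDistanceGenerating P.params ω ω') (ηL η γ : ℝ) (T m : ℕ) {s : E}
    (hs : s ∈ subdiffDomain P.params ω) (r : Fin n → ℝ) (a : E) :
    Measurable fun z =>
      OracleAlg.law P.dist (.draw (hedge η r) fun k => .query k fun z' =>
        P.recipeLoop (mirrorDescent P.params ω ω' ηL) (exp3IX n η γ) T m
        ((mirrorDescent P.params ω ω' ηL).update s (P.grad s z))
        ((exp3IX n η γ).update r (k, 1 - P.loss (P.model s) z'))
        (a + (mirrorDescent P.params ω ω' ηL).update s (P.grad s z))) :=
  have h := (measurable_law_recipeLoop_step_of hP hω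
    (measurable_law_recipeLoop hP hω ηL η γ T m)).comp
      (measurable_prodMk_left (x := ((⟨s, hs⟩ : subdiffDomain P.params ω), r, a)))
  h

end Recipe

end GroupDRO

/-! ### Exponential moments of one iteration. -/

theorem integral_const_add_const_mul {Z : Type*} [MeasurableSpace Z] {μ : Measure Z}
    [IsProbabilityMeasure μ] {Y : Z → ℝ} (hY : Integrable Y μ) (b c : ℝ) :
    ∫ z, (c + b * Y z) ∂μ = c + b * ∫ z, Y z ∂μ := by
  rw [integral_add (integrable_const c) (hY.const_mul b), integral_const_mul]
  simp

/-- The exponential moment bound for the learner's cost in one iteration. -/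
theorem sum_integral_learner_le {n : ℕ} {Z : Type*} [MeasurableSpace Z] {D : Fin n → Measure Z}
    [∀ i, IsProbabilityMeasure (D i)] (w : stdSimplex ℝ (Fin n)) {Y : Z → ℝ}
    (hY : ∀ i, Integrable Y (D i)) (lam : ℝ) :
    ∑ i, w.1 i * ∫ z, (1 - lam * Y z + lam ^ 2) ∂D i
      ≤ Real.exp (-(lam * ∑ i, w.1 i * ∫ z, Y z ∂D i) + lam ^ 2) := by
  have h : ∀ i, ∫ z, (1 - lam * Y z + lam ^ 2) ∂D i = 1 + lam ^ 2 - lam * ∫ z, Y z ∂D i := by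
    intro i
    rw [sub_eq_add_neg, ← neg_mul, ← integral_const_add_const_mul (hY i)]
    exact integral_congr_ae (Filter.Eventually.of_forall fun z => by ring)
  have h2 : ∑ i, w.1 i * (1 + lam ^ 2 - lam * ∫ z, Y z ∂D i)
      = (1 + lam ^ 2) * ∑ i, w.1 i - lam * ∑ i, w.1 i * ∫ z, Y z ∂D i := by
    rw [Finset.mul_sum, Finset.mul_sum, ← Finset.sum_sub_distrib]
    exact Finset.sum_congr rfl fun i _ => by ring
  simp only [h]
  rw [h2, w.2.2]
  refine le_trans (le_of_eq ?_) (Real.add_one_le_exp _)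
  ring

/-- The exponential moment bound for the auditor's cost in one iteration. -/
theorem sum_integral_auditor_le {n : ℕ} {Z : Type*} [MeasurableSpace Z] {D : Fin n → Measure Z}
    [∀ i, IsProbabilityMeasure (D i)] (w : stdSimplex ℝ (Fin n)) (hw : ∀ i, 0 < w.1 i) {X : Z → ℝ}
    (hX : ∀ i, Integrable X (D i)) (hX1 : ∀ z, X z ≤ 1) {lam η : ℝ} (hlam : 0 ≤ lam) (hη : 0 ≤ η)
    (j : Fin n) :
    ∑ k, w.1 k * ∫ z, (1 - lam * X z + lam ^ 2
        + lam * (η + if k = j then 1 else 0) * (X z / w.1 k)) ∂D k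
      ≤ Real.exp (-(lam * ∑ k, w.1 k * ∫ z, X z ∂D k) + lam ^ 2
        + lam * (η * n + ∫ z, X z ∂D j)) := by
  -- The sampling weight cancels the importance factor 1/w_k: exploration costs η times a sum of n
  -- means, each at most 1, and the indicator isolates the mean under `D j`.
  have h : ∀ k, w.1 k * ∫ z, (1 - lam * X z + lam ^ 2
      + lam * (η + if k = j then 1 else 0) * (X z / w.1 k)) ∂D k
      = (1 + lam ^ 2) * w.1 k - lam * (w.1 k * ∫ z, X z ∂D k)
        + (lam * η * (∫ z, X z ∂D k) + lam * if k = j then ∫ z, X z ∂D k else 0) := by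
    intro k
    have h1 : ∫ z, (1 - lam * X z + lam ^ 2
        + lam * (η + if k = j then 1 else 0) * (X z / w.1 k)) ∂D k
        = 1 + lam ^ 2 + (lam * (η + if k = j then 1 else 0) / w.1 k - lam) * ∫ z, X z ∂D k := by
      rw [← integral_const_add_const_mul (hX k)]
      exact integral_congr_ae (Filter.Eventually.of_forall fun z => by ring)
    have h2 := (hw k).ne'
    rw [h1]
    split_ifs <;> field_simp <;> ring
  have hm : ∑ k, ∫ z, X z ∂D k ≤ n := by
    have h1 : ∀ k, ∫ z, X z ∂D k ≤ 1 := fun k => by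
      calc _ ≤ ∫ _, (1 : ℝ) ∂D k := integral_mono (hX k) (integrable_const 1) hX1
        _ = 1 := by simp
    simpa using Finset.sum_le_sum fun k (_ : k ∈ Finset.univ) => h1 k
  simp only [h]
  rw [Finset.sum_add_distrib, Finset.sum_add_distrib, Finset.sum_sub_distrib, ← Finset.mul_sum,
    ← Finset.mul_sum, ← Finset.mul_sum, ← Finset.mul_sum, w.2.2]
  simp only [Finset.sum_ite_eq', Finset.mem_univ, if_true]
  refine le_trans ?_ (Real.add_one_le_exp _)
  have := mul_le_mul_of_nonneg_left hm (mul_nonneg hlam hη)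
  linarith

/-! ### The potential argument along the execution tree. -/

namespace GroupDRO

variable {n : ℕ} {E Z H : Type*} [NormedAddCommGroup E] [NormedSpace ℝ E] [MeasurableSpace Z]
  [FiniteDimensional ℝ E] [MeasurableSpace E] [BorelSpace E] {P : GroupDRO n E Z H} [NeZero n]
  {ω : E → ℝ} {ω' : E → E →L[ℝ] ℝ}

/-- Used with `B = univ`, for total mass one, and with `B = P.params`, for properness of the output.
-/
theorem law_recipeLoop_eq_one (hP : P.IsSmoothConvex)
    (hω : IsDistanceGenerating P.params ω ω') (ηL η γ : ℝ) (T : ℕ) {B : Set E}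
    (hB : MeasurableSet B) (hBP : P.params ⊆ B) (m t : ℕ) (ht : 0 < t) (htm : t + m = T) (s : E)
    (hs : s ∈ subdiffDomain P.params ω) (r : Fin n → ℝ) (a : E)
    (ha : (t : ℝ)⁻¹ • a ∈ P.params) :
    OracleAlg.law P.dist
      (P.recipeLoop (mirrorDescent P.params ω ω' ηL) (exp3IX n η γ) T m s r a) B = 1 := by
  have := hP.isProbabilityMeasure
  induction m generalizing t s r a with
  | zero =>
    subst htm
    exact (Measure.dirac_apply' _ hB).trans (indicator_of_mem (hBP ha) _)
  | succ m ih =>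
    have hs' := fun z => mirrorDescent_update_mem hP.isCompact hω hs.1 ηL (P.grad s z)
    have ha' := fun z => (hP.average_mem (Nat.cast_pos.2 ht) ha (hs' z).1).1
    rw [recipeLoop_mirrorDescent_succ]
    refine OracleAlg.law_draw_query_eq_one _
      (fun _ => measurable_law_recipeLoop_step hP hω ηL η γ T m hs r a) hB fun i z => ?_
    refine OracleAlg.law_draw_query_eq_one _
      (measurable_law_recipeLoop_update hP hω ηL η γ T m hs r a z) hB fun k z' => ?_
    refine ih (t + 1) t.succ_pos (by omega) _ (hs' z) _ _ ?_
    rw [Nat.cast_succ]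
    exact ha' z

/-- The potential argument: with `ρ` bounding the suboptimality of the last action, the exponential
of the sum of the players' potentials bounds the probability that the average exceeds `v + ε` on the
`j`-th distribution. -/
theorem law_recipeLoop_le (hP : P.IsSmoothConvex)
    (hω : IsDistanceGenerating P.params ω ω') {T : ℕ} {u : E} (hu : u ∈ P.params) {v ε ρ : ℝ}
    (huv : ∀ i, P.risk i (P.model u) ≤ v) (hρ : ∀ θ ∈ P.params, ‖θ - u‖ ≤ ρ)
    {ηL η lam : ℝ} (hηL : ηL = √(2 * bregmanRadius P.params ω ω' / T)) (hη : 0 < η)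
    (hlam : 0 ≤ lam) (hlam1 : lam ≤ 1) (hlamη : lam * (η + 1) ≤ η) (j : Fin n)
    (m t : ℕ) (ht : 0 < t) (htm : t + m = T) (s : E)
    (hs : s ∈ subdiffDomain P.params ω) (r : Fin n → ℝ) (a : E)
    (ha : (t : ℝ)⁻¹ • a ∈ P.params) (G : ℝ)
    (hG : t * P.risk j (P.model ((t : ℝ)⁻¹ • a)) - t * v ≤ G + (P.risk j (P.model s) - v)) :
    OracleAlg.law P.dist
      (P.recipeLoop (mirrorDescent P.params ω ω' ηL) (exp3IX n η (η / 2)) T m s r a)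
      {x | x ∈ P.params ∧ P.risk j (P.model x) ≤ v + ε}ᶜ
    ≤ ENNReal.ofReal (Real.exp (lam * (G + bregman ω ω' s u / ηL + hedgePotential η j r
        - (T * ε - ρ)) + m * (2 * lam ^ 2 + lam * η * n + lam * ηL / 2))) := by
  have := hP.isProbabilityMeasure
  have hB : MeasurableSet {x | x ∈ P.params ∧ P.risk j (P.model x) ≤ v + ε}ᶜ :=
    ((hP.continuousOn_risk j).preimage_isClosed_of_isClosed hP.isCompact.isClosed
      isClosed_Iic).measurableSet.compl
  have hηL0 : 0 ≤ ηL := hηL ▸ Real.sqrt_nonneg _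
  -- `G` covers only the actions before the current `s`; the excess of `s` joins it at the next
  -- iteration. At the leaf the last action is uncharged, and 1-Lipschitzness of the risk bounds its
  -- excess by `ρ`.
  induction m generalizing t s r a G with
  | zero =>
    have hT : t = T := by omega
    subst hT
    change Measure.dirac ((t : ℝ)⁻¹ • a) _ ≤ _
    rw [Measure.dirac_apply' _ hB]
    by_cases hx : (t : ℝ)⁻¹ • a ∈ {x | x ∈ P.params ∧ P.risk j (P.model x) ≤ v + ε}ᶜ
    · rw [indicator_of_mem hx, Pi.one_apply, ← ENNReal.ofReal_one]
      refine ENNReal.ofReal_le_ofReal (Real.one_le_exp ?_)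
      rw [Nat.cast_zero, zero_mul, add_zero]
      refine mul_nonneg hlam ?_
      have hx' : v + ε < P.risk j (P.model ((t : ℝ)⁻¹ • a)) := by
        by_contra! h
        exact hx ⟨ha, h⟩
      have h1 := mul_le_mul_of_nonneg_left hx'.le (Nat.cast_nonneg (α := ℝ) t)
      have h2 : 0 ≤ bregman ω ω' s u / ηL :=
        div_nonneg ((by positivity : (0 : ℝ) ≤ _).trans (hω.half_sq_le_bregman hs hu)) hηL0
      have h3 := hedgePotential_nonneg hη j r
      have h4 := hP.risk_sub_le_norm hs.1 hu j
      linarith [hρ s hs.1, huv j]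
    · rw [indicator_of_notMem hx]
      exact zero_le
  | succ m ih =>
    have hs' := fun z => mirrorDescent_update_mem hP.isCompact hω hs.1 ηL (P.grad s z)
    have hT : 0 < T := by omega
    let w := hedge η r
    let Y : Z → ℝ := fun z => P.loss (P.model s) z - P.loss (P.model u) z
    let X : Z → ℝ := fun z => 1 - P.loss (P.model s) z
    have hY : ∀ i, Integrable Y (P.dist i) := fun i =>
      (hP.integrable_loss hs.1 i).sub (hP.integrable_loss hu i)
    have hX : ∀ i, Integrable X (P.dist i) := fun i =>
      (integrable_const 1).sub (hP.integrable_loss hs.1 i)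
    have hXmem : ∀ z, X z ∈ Icc (0 : ℝ) 1 := fun z => by
      have := hP.loss_mem s hs.1 z
      exact ⟨sub_nonneg.2 this.2, sub_le_self _ this.1⟩
    have hYabs : ∀ z, |lam * Y z| ≤ 1 := fun z => by
      have h1 := hP.loss_mem s hs.1 z
      have h2 := hP.loss_mem u hu z
      rw [abs_mul, abs_of_nonneg hlam]
      exact mul_le_one₀ hlam1 (abs_nonneg _) (abs_le.2 ⟨by simp only [Y]; linarith [h1.1, h2.2],
        by simp only [Y]; linarith [h1.2, h2.1]⟩)
    let p : Z → ℝ := fun z => 1 - lam * Y z + lam ^ 2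
    let q : Fin n → Z → ℝ := fun k z =>
      1 - lam * X z + lam ^ 2 + lam * (η + if k = j then 1 else 0) * (X z / w.1 k)
    -- Everything unaffected by this iteration's samples. The bound for the continuation then
    -- factors as `C * p z * q k z'`, and the two independent rounds integrate separately.
    let C : ℝ := Real.exp (lam * (G + (P.risk j (P.model s) - v) + bregman ω ω' s u / ηL + ηL / 2
      + hedgePotential η j r - (T * ε - ρ)) + m * (2 * lam ^ 2 + lam * η * n + lam * ηL / 2))
    have hC : 0 ≤ C := (Real.exp_pos _).le
    have hp0 : ∀ z, 0 ≤ p z := fun z => by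
      have := (abs_le.1 (hYabs z)).2
      simp only [p]; nlinarith [sq_nonneg lam]
    have hq0 : ∀ k z, 0 ≤ q k z := fun k z => by
      have h1 : lam * X z ≤ 1 := mul_le_one₀ hlam1 (hXmem z).1 (hXmem z).2
      have h2 : 0 ≤ lam * (η + if k = j then 1 else 0) * (X z / w.1 k) := by
        refine mul_nonneg (mul_nonneg hlam ?_) (div_nonneg (hXmem z).1 (hedge_pos η r k).le)
        split_ifs <;> linarith
      simp only [q]; nlinarith [sq_nonneg lam]
    have hp : ∀ i, Integrable p (P.dist i) := fun i =>
      ((integrable_const 1).sub ((hY i).const_mul lam)).add (integrable_const _)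
    have hq : ∀ k, Integrable (q k) (P.dist k) := fun k =>
      (((integrable_const 1).sub ((hX k).const_mul lam)).add (integrable_const _)).add
        (((hX k).div_const _).const_mul _)
    let Q : ℝ := ∑ k, w.1 k * ∫ z, q k z ∂P.dist k
    have hQ0 : 0 ≤ Q := Finset.sum_nonneg fun k _ =>
      mul_nonneg (w.2.1 k) (integral_nonneg (hq0 k))
    have hstep : ∀ z k z', OracleAlg.law P.dist
        (P.recipeLoop (mirrorDescent P.params ω ω' ηL) (exp3IX n η (η / 2)) T m
          ((mirrorDescent P.params ω ω' ηL).update s (P.grad s z))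
          ((exp3IX n η (η / 2)).update r (k, X z'))
          (a + (mirrorDescent P.params ω ω' ηL).update s (P.grad s z)))
        {x | x ∈ P.params ∧ P.risk j (P.model x) ≤ v + ε}ᶜ
        ≤ ENNReal.ofReal (C * p z * q k z') := by
      intro z k z'
      have hav := hP.average_mem (Nat.cast_pos.2 ht) ha (hs' z).1
      have h1 := ih (t + 1) t.succ_pos (by omega) _ (hs' z)
        ((exp3IX n η (η / 2)).update r (k, X z')) _ (by rw [Nat.cast_succ]; exact hav.1)
        (G + (P.risk j (P.model s) - v)) (by
          rw [Nat.cast_succ]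
          have := hav.2 j
          linarith)
      refine h1.trans (ENNReal.ofReal_le_ofReal ?_)
      have h2 := mul_le_mul_of_nonneg_left (bregman_div_update_le hP hω hT hu hs z hηL) hlam
      have h3 := exp_hedgePotential_update_le hη hlam hlam1 hlamη (hXmem z') j k r
      have h4 := Real.exp_neg_le_one_sub_add_sq (hYabs z)
      have h5 : (lam * Y z) ^ 2 ≤ lam ^ 2 := by
        have hY1 : Y z ^ 2 ≤ 1 := by
          have h1 := hP.loss_mem s hs.1 z
          have h2 := hP.loss_mem u hu z
          rw [sq_le_one_iff_abs_le_one]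
          exact abs_le.2 ⟨by simp only [Y]; linarith [h1.1, h2.2],
            by simp only [Y]; linarith [h1.2, h2.1]⟩
        rw [mul_pow]
        exact mul_le_of_le_one_right (sq_nonneg _) hY1
      set Λ' := bregman ω ω' ((mirrorDescent P.params ω ω' ηL).update s (P.grad s z)) u / ηL
      set Φ' := hedgePotential η j ((exp3IX n η (η / 2)).update r (k, X z'))
      set K := 2 * lam ^ 2 + lam * η * n + lam * ηL / 2
      let c := lam * (G + (P.risk j (P.model s) - v) + bregman ω ω' s u / ηL + ηL / 2
        - (T * ε - ρ)) + m * K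
      calc _ ≤ Real.exp (c + -(lam * Y z) + lam * Φ') := Real.exp_le_exp.2 (by
            simp only [c, Y]; linarith)
        _ = Real.exp c * Real.exp (-(lam * Y z)) * Real.exp (lam * Φ') := by
            rw [Real.exp_add, Real.exp_add]
        _ ≤ Real.exp c * p z * (Real.exp (lam * hedgePotential η j r) * q k z') := by
            gcongr
            · exact mul_nonneg (Real.exp_pos _).le (hp0 z)
            · simp only [p]; linarith
        _ = C * p z * q k z' := by
            have : C = Real.exp c * Real.exp (lam * hedgePotential η j r) := by
              rw [← Real.exp_add]; simp only [C, c, K]; congr 1; ring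
            rw [this]; ring
    have hfin : OracleAlg.law P.dist
        (P.recipeLoop (mirrorDescent P.params ω ω' ηL) (exp3IX n η (η / 2)) T (m + 1) s r a)
        {x | x ∈ P.params ∧ P.risk j (P.model x) ≤ v + ε}ᶜ
        ≤ ENNReal.ofReal (∑ i, w.1 i * ∫ z, C * Q * p z ∂P.dist i) := by
      rw [recipeLoop_mirrorDescent_succ]
      refine OracleAlg.law_draw_query_le w
        (fun _ => measurable_law_recipeLoop_step hP hω ηL η _ T m hs r a) hB
        (fun i z => mul_nonneg (mul_nonneg hC hQ0) (hp0 z)) (fun i => (hp i).const_mul _)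
        fun i z => ?_
      refine (OracleAlg.law_draw_query_le w
        (measurable_law_recipeLoop_update hP hω ηL η _ T m hs r a z) hB
        (fun k z' => mul_nonneg (mul_nonneg hC (hp0 z)) (hq0 k z'))
        (fun k => (hq k).const_mul _) fun k z' => hstep z k z').trans
        (ENNReal.ofReal_le_ofReal (le_of_eq ?_))
      simp only [integral_const_mul, Q, Finset.mul_sum, Finset.sum_mul]
      exact Finset.sum_congr rfl fun k _ => by ring
    refine hfin.trans (ENNReal.ofReal_le_ofReal ?_)
    have hsum : ∑ i, w.1 i * ∫ z, C * Q * p z ∂P.dist i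
        = C * (Q * ∑ i, w.1 i * ∫ z, p z ∂P.dist i) := by
      simp only [integral_const_mul, Finset.mul_sum]
      exact Finset.sum_congr rfl fun i _ => by ring
    have hpsum := sum_integral_learner_le w hY lam
    have hqsum : Q ≤ _ := sum_integral_auditor_le w (hedge_pos η r) hX (fun z => (hXmem z).2)
      hlam hη.le j
    have hp0sum : 0 ≤ ∑ i, w.1 i * ∫ z, p z ∂P.dist i :=
      Finset.sum_nonneg fun i _ => mul_nonneg (w.2.1 i) (integral_nonneg hp0)
    have hYi : ∀ i, ∫ z, Y z ∂P.dist i = P.risk i (P.model s) - P.risk i (P.model u) := fun i =>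
      integral_sub (hP.integrable_loss hs.1 i) (hP.integrable_loss hu i)
    have hXi : ∀ i, ∫ z, X z ∂P.dist i = 1 - P.risk i (P.model s) := fun i => by
      rw [integral_sub (integrable_const 1) (hP.integrable_loss hs.1 i)]
      simp [risk]
    -- The game-theoretic cancellation: the risks of `s` under `w` drop out, leaving 1 - Σ w_i
    -- R_i(u). Together with the auditor's term 1 - R_j(s), this offsets the increment R_j(s) - v of
    -- `G`.
    have hv : 1 - v ≤ ∑ i, w.1 i * ∫ z, Y z ∂P.dist i + ∑ i, w.1 i * ∫ z, X z ∂P.dist i := by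
      rw [← Finset.sum_add_distrib]
      calc 1 - v = ∑ i, w.1 i * (1 - v) := by rw [← Finset.sum_mul, w.2.2, one_mul]
        _ ≤ _ := Finset.sum_le_sum fun i _ => by
          rw [hYi, hXi, ← mul_add]
          exact mul_le_mul_of_nonneg_left (by linarith [huv i]) (w.2.1 i)
    have hlv := mul_le_mul_of_nonneg_left hv hlam
    rw [hsum]
    refine (mul_le_mul_of_nonneg_left (mul_le_mul hqsum hpsum hp0sum (Real.exp_pos _).le)
      hC).trans ?_
    rw [← Real.exp_add, ← Real.exp_add, hXi]
    refine Real.exp_le_exp.2 ?_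
    push_cast
    linarith

end GroupDRO

/-! ### Step sizes, union bound and conclusion. -/

/-- The choice of the step sizes makes the failure probability of a single distribution at most
`δ / n`, here as a bound for the exponent. -/
theorem exponent_le_neg_log {N D T ε L l : ℝ} (hN : 1 ≤ N) (hD : 0 ≤ D) (hT : 1 ≤ T) (hε : 0 < ε)
    (hL : 0 < L) (hl : l ≤ L) (hTε : 100 * (D + N * L) ≤ ε ^ 2 * T) {m η ηL : ℝ}
    (hm : m ≤ T) (hη : η = √(L / (N * T))) (hηL : ηL = √(2 * D / T)) :
    η / 2 * (D / ηL + l / η - (T * ε - 2 * √(2 * D)))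
      + m * (2 * (η / 2) ^ 2 + η / 2 * η * N + η / 2 * ηL / 2) ≤ -L := by
  have hT0 : 0 < T := by linarith
  have hN0 : 0 < N := by linarith
  -- All terms are measured in q = √(NLT) for the auditor and p = √(2DT) for the learner: ηNT = q,
  -- ηq = L and η_L T = p.
  set q := √(N * L * T) with hq
  set p := √(2 * D * T) with hp
  have hq2 : q ^ 2 = N * L * T := Real.sq_sqrt (by positivity)
  have hp2 : p ^ 2 = 2 * D * T := Real.sq_sqrt (by positivity)
  have hq0 : 0 < q := Real.sqrt_pos.2 (by positivity)
  have hp0 : 0 ≤ p := Real.sqrt_nonneg _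
  have hηq : η = q / (N * T) := by
    rw [hη, Real.sqrt_eq_iff_mul_self_eq (by positivity) (by positivity)]
    field_simp
    linarith
  have hηp : ηL = p / T := by
    rw [hηL, Real.sqrt_eq_iff_mul_self_eq (by positivity) (by positivity)]
    field_simp
    linarith
  have hη0 : 0 < η := hηq ▸ by positivity
  have hηL0 : 0 ≤ ηL := hηp ▸ by positivity
  have hLq : L = η * q := by
    rw [hηq]; field_simp; linarith
  have hNη : η * N * T = q := by
    rw [hηq]; field_simp
  have hηT : η * T ≤ q := by
    rw [← hNη]
    nlinarith [mul_pos hη0 hT0]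
  have hηLT : ηL * T = p := by
    rw [hηp]; field_simp
  have hDL : D / ηL ≤ p / 2 := by
    rcases hηL0.eq_or_lt with h | h
    · rw [← h, div_zero]; positivity
    · rw [div_le_iff₀ h, hηp]
      refine le_of_eq ?_
      field_simp
      linarith
  have hlη : l / η ≤ q := by
    rw [div_le_iff₀ hη0]; linarith
  have hρ : √(2 * D) ≤ p := Real.sqrt_le_sqrt (le_mul_of_one_le_right (by positivity) hT)
  have hεT : 0 < ε * T := by positivity
  have hq1 : q ≤ ε * T / 10 := by
    refine abs_le_of_sq_le_sq' ?_ (by positivity) |>.2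
    rw [hq2]
    nlinarith [mul_nonneg hD hT0.le]
  -- The constant 100 gives 5q + 3p ≤ 0.95 εT < εT, so the bracket is at most -2q and half of η
  -- times it is -L.
  have hp1 : p ≤ 3 * (ε * T) / 20 := by
    refine abs_le_of_sq_le_sq' ?_ (by positivity) |>.2
    rw [hp2]
    nlinarith [mul_pos (mul_pos hN0 hL) hT0, sq_nonneg (ε * T)]
  have hstep : m * (2 * (η / 2) ^ 2 + η / 2 * η * N + η / 2 * ηL / 2)
      ≤ η / 2 * (q + q + p / 2) := by
    refine (mul_le_mul_of_nonneg_right hm (by positivity)).trans ?_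
    have : T * (2 * (η / 2) ^ 2 + η / 2 * η * N + η / 2 * ηL / 2)
        = η / 2 * (η * T + η * N * T + ηL * T / 2) := by ring
    rw [this, hNη, hηLT]
    gcongr
  have hfirst : η / 2 * (D / ηL + l / η - (T * ε - 2 * √(2 * D)))
      ≤ η / 2 * (p / 2 + q - (T * ε - 2 * p)) := by
    gcongr
  have hfin : η / 2 * (p / 2 + q - (T * ε - 2 * p) + (q + q + p / 2)) ≤ η / 2 * (-(2 * q)) :=
    mul_le_mul_of_nonneg_left (by linarith) (by positivity)
  linarith

namespace GroupDRO

variable {n : ℕ} {E Z H : Type*} [NormedAddCommGroup E] [NormedSpace ℝ E] [MeasurableSpace Z]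
  {P : GroupDRO n E Z H} {ω : E → ℝ} {ω' : E → E →L[ℝ] ℝ}

theorem log_div_pos [NeZero n] {δ : ℝ} (hδ : 0 < δ) (hδ1 : δ < 1) : 0 < Real.log (n / δ) := by
  have hn : (1 : ℝ) ≤ n := Nat.one_le_cast.2 (NeZero.one_le)
  refine Real.log_pos ?_
  rw [lt_div_iff₀ hδ]; linarith

variable [FiniteDimensional ℝ E] [MeasurableSpace E] [BorelSpace E] [NeZero n]

theorem law_mirrorDescentRecipe_compl_le (hP : P.IsSmoothConvex)
    (hω : IsDistanceGenerating P.params ω ω') {ε δ : ℝ} (hε : 0 < ε) (hε1 : ε ≤ 1) (hδ : 0 < δ)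
    (hδ1 : δ < 1) {T : ℕ} (hT : 0 < T)
    (hTε : 100 * (bregmanRadius P.params ω ω' + n * Real.log (n / δ)) ≤ ε ^ 2 * T) (j : Fin n) :
    OracleAlg.law P.dist (P.mirrorDescentRecipe ω ω' δ T)
      {x | x ∈ P.params ∧ P.risk j (P.model x) ≤ P.opt + ε}ᶜ ≤ ENNReal.ofReal (δ / n) := by
  obtain ⟨u, hu, huv⟩ := hP.exists_risk_le_opt
  have hn : (1 : ℝ) ≤ n := Nat.one_le_cast.2 NeZero.one_le
  have hT1 : (1 : ℝ) ≤ T := Nat.one_le_cast.2 hT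
  have hL := log_div_pos (n := n) hδ hδ1
  have hD := hω.bregmanRadius_nonneg hP.isCompact hP.nonempty
  have hc := center_mem hP.isCompact hP.nonempty hω.continuousOn
  set L := Real.log (n / δ) with hLdef
  set D := bregmanRadius P.params ω ω' with hDdef
  set η := √(L / (n * T)) with hη
  set ηL := √(2 * D / T) with hηL
  have hη0 : 0 < η := Real.sqrt_pos.2 (by positivity)
  have hη1 : η ≤ 1 := by
    rw [hη, Real.sqrt_le_one, div_le_one (by positivity)]
    have h1 : ε ^ 2 * T ≤ T := mul_le_of_le_one_left (by positivity) (pow_le_one₀ hε.le hε1)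
    nlinarith
  -- With `η ≤ 1`, `lam = η / 2` satisfies `lam * (η + 1) ≤ η`. The recursion starts with one action
  -- already averaged and `T - 1` iterations left.
  have h := law_recipeLoop_le hP hω (T := T) hu huv (ε := ε) (ρ := 2 * √(2 * D))
    (fun θ hθ => hω.norm_sub_le_sqrt hP.isCompact hθ hu) hηL hη0 (lam := η / 2)
    (by positivity) (by linarith) (by nlinarith) j (T - 1) 1 one_pos (by omega) _ hc 0
    (center P.params ω) (by simpa using hc.1) 0 (by simp)
  refine h.trans (ENNReal.ofReal_le_ofReal ?_)
  have hV : bregman ω ω' (center P.params ω) u / ηL ≤ D / ηL :=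
    div_le_div_of_nonneg_right (hω.bregman_center_le hP.isCompact hu) (Real.sqrt_nonneg _)
  have hl : Real.log n ≤ L :=
    Real.log_le_log (by linarith) (le_div_self (by linarith) hδ hδ1.le)
  have hexp := exponent_le_neg_log (l := Real.log n) (m := ((T - 1 : ℕ) : ℝ)) hn hD hT1 hε hL hl hTε
    (Nat.cast_le.2 (Nat.sub_le T 1)) hη hηL
  have hδn : δ / n = Real.exp (-L) := by
    rw [Real.exp_neg, hLdef, Real.exp_log (by positivity), inv_div]
  rw [hδn, hedgePotential_zero, zero_add]
  refine Real.exp_le_exp.2 (le_trans ?_ hexp)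
  gcongr

theorem law_mirrorDescentRecipe_eq_one (hP : P.IsSmoothConvex)
    (hω : IsDistanceGenerating P.params ω ω') (δ : ℝ) {T : ℕ} (hT : 0 < T) {B : Set E}
    (hB : MeasurableSet B) (hBP : P.params ⊆ B) :
    OracleAlg.law P.dist (P.mirrorDescentRecipe ω ω' δ T) B = 1 := by
  have hc := center_mem hP.isCompact hP.nonempty hω.continuousOn
  exact law_recipeLoop_eq_one hP hω _ _ _ T hB hBP (T - 1) 1 one_pos (by omega) _ hc 0
    (center P.params ω) (by simpa using hc.1)

/-- For ε ≤ 1, a union bound over the groups. For ε ≥ 1 every parameter is ε-optimal, as risks lie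
in [0, 1], so properness suffices. -/
theorem ofReal_one_sub_le_law_mirrorDescentRecipe (hP : P.IsSmoothConvex)
    (hω : IsDistanceGenerating P.params ω ω') {ε δ : ℝ} (hε : 0 < ε) (hδ : 0 < δ)
    (hδ1 : δ < 1) {T : ℕ} (hT : 0 < T)
    (hTε : 100 * (bregmanRadius P.params ω ω' + n * Real.log (n / δ)) ≤ ε ^ 2 * T) :
    ENNReal.ofReal (1 - δ)
      ≤ OracleAlg.law P.dist (P.mirrorDescentRecipe ω ω' δ T) (P.epsOptimal ε) := by
  set μ := OracleAlg.law P.dist (P.mirrorDescentRecipe ω ω' δ T)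
  rcases le_total ε 1 with hε1 | hε1
  · have huniv : μ univ = 1 :=
      law_mirrorDescentRecipe_eq_one hP hω δ hT MeasurableSet.univ (subset_univ _)
    have hn : (n : ℝ) ≠ 0 := Nat.cast_ne_zero.2 (NeZero.ne n)
    have hsub : (P.epsOptimal ε)ᶜ
        ⊆ ⋃ j, {x | x ∈ P.params ∧ P.risk j (P.model x) ≤ P.opt + ε}ᶜ := by
      intro x hx
      by_contra h
      simp only [mem_iUnion, mem_compl_iff, not_exists, not_not] at h
      exact hx (mem_epsOptimal (h 0).1 fun i => (h i).2)
    have hcompl : μ (P.epsOptimal ε)ᶜ ≤ ENNReal.ofReal δ :=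
      calc μ (P.epsOptimal ε)ᶜ ≤ _ := measure_mono hsub
        _ ≤ ∑ j, μ {x | x ∈ P.params ∧ P.risk j (P.model x) ≤ P.opt + ε}ᶜ :=
          measure_iUnion_fintype_le _ _
        _ ≤ ∑ _j : Fin n, ENNReal.ofReal (δ / n) := Finset.sum_le_sum fun j _ =>
          law_mirrorDescentRecipe_compl_le hP hω hε hε1 hδ hδ1 hT hTε j
        _ = ENNReal.ofReal δ := by
          rw [← ENNReal.ofReal_sum_of_nonneg fun _ _ => by positivity]
          simp [mul_div_cancel₀ _ hn]
    -- Subadditivity suffices, so measurability of `P.epsOptimal ε` is not needed.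
    have hle : 1 ≤ μ (P.epsOptimal ε) + μ (P.epsOptimal ε)ᶜ := by
      rw [← huniv, ← union_compl_self (P.epsOptimal ε)]
      exact measure_union_le _ _
    rw [ENNReal.ofReal_sub _ hδ.le, ENNReal.ofReal_one, tsub_le_iff_right]
    exact hle.trans (by gcongr)
  · have hopt : 0 ≤ P.opt := by
      obtain ⟨u, hu, huv⟩ := hP.exists_risk_le_opt
      exact (hP.risk_mem hu 0).1.trans (huv 0)
    have hsub : P.params ⊆ P.epsOptimal ε := fun x hx =>
      mem_epsOptimal hx fun i => by linarith [(hP.risk_mem hx i).2]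
    calc ENNReal.ofReal (1 - δ) ≤ 1 := ENNReal.ofReal_le_one.2 (by linarith)
      _ = μ P.params :=
        (law_mirrorDescentRecipe_eq_one hP hω δ hT hP.isCompact.isClosed.measurableSet
          subset_rfl).symm
      _ ≤ _ := measure_mono hsub

end GroupDRO

end

theorem mainTheorem4 :
    ∃ C : ℝ, 0 < C ∧
      ∀ (n : ℕ) [NeZero n]
        (E : Type*) [NormedAddCommGroup E] [NormedSpace ℝ E] [FiniteDimensional ℝ E]
        [MeasurableSpace E] [BorelSpace E]
        (Z : Type*) [MeasurableSpace Z] (H : Type*)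
        (P : GroupDRO n E Z H) (_ : P.IsSmoothConvex)
        (ω : E → ℝ) (ω' : E → E →L[ℝ] ℝ) (_ : IsDistanceGenerating P.params ω ω')
        (ε δ : ℝ) (_ : 0 < ε) (_ : 0 < δ) (_ : δ < 1)
        (T : ℕ) (_ : T = ⌈C * (P.complexity ω ω' δ / ε ^ 2)⌉₊),
        (∃ N : ℕ, (P.mirrorDescentRecipe ω ω' δ T).CallsAtMost N ∧
          (N : ℝ) ≤ 2 * C * (P.complexity ω ω' δ / ε ^ 2)) ∧
        ENNReal.ofReal (1 - δ) ≤
          (P.mirrorDescentRecipe ω ω' δ T).law P.dist (P.epsOptimal ε) := by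
  refine ⟨100, by norm_num, ?_⟩
  intro n _ E _ _ _ _ _ Z _ H P hP ω ω' hω ε δ hε hδ hδ1 T hT
  have hL := GroupDRO.log_div_pos (n := n) hδ hδ1
  have hn : (0 : ℝ) < n := Nat.cast_pos.2 (NeZero.pos n)
  have hD := hω.bregmanRadius_nonneg hP.isCompact hP.nonempty
  have hR : 0 ≤ Metric.diam P.params * Real.log (1 / δ) :=
    mul_nonneg Metric.diam_nonneg (Real.log_nonneg (by rw [le_div_iff₀ hδ]; linarith))
  have hnL : 0 < n * Real.log (n / δ) := mul_pos hn hL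
  have hX : bregmanRadius P.params ω ω' + n * Real.log (n / δ) ≤ P.complexity ω ω' δ := by
    rw [GroupDRO.complexity]; linarith
  have hpos : 0 < 100 * (P.complexity ω ω' δ / ε ^ 2) := by
    have : 0 < P.complexity ω ω' δ := by linarith
    positivity
  have hT0 : 0 < T := hT ▸ Nat.ceil_pos.2 hpos
  have hceil : 100 * (P.complexity ω ω' δ / ε ^ 2) ≤ T := hT ▸ Nat.le_ceil _
  refine ⟨⟨2 * (T - 1), GroupDRO.callsAtMost_recipeLoop P _ _ T (T - 1) _ _ _, ?_⟩,
    GroupDRO.ofReal_one_sub_le_law_mirrorDescentRecipe hP hω hε hδ hδ1 hT0 ?_⟩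
  -- Only `T - 1` iterations query the oracles, twice each, which absorbs the rounding up in `T`.
  · have h1 : (T : ℝ) < 100 * (P.complexity ω ω' δ / ε ^ 2) + 1 := hT ▸ Nat.ceil_lt_add_one hpos.le
    rw [Nat.cast_mul, Nat.cast_sub hT0]
    push_cast
    linarith
  · rw [← mul_div_assoc, div_le_iff₀ (by positivity)] at hceil
    linarith
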